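/- Let $(G,\chi)$ be a vertex-colored graph: $G$ is a finite, non-empty, simple undirected graph and $\chi\colon V(G)\to C$ is any map into a set $C$ of colors (an uncolored graph is the case of a constant coloring). For $k\ge 1$, the $k$-dimensional Weisfeiler–Leman algorithm ($k$-WL) colors the $k$-tuples of vertices as follows. Initially, $\bar v=(v_1,\dots,v_k)$ is colored by $\mathrm{wl}_0(\bar v)$, the isomorphism type of the ordered colored subgraph induced by $v_1,\dots,v_k$. If $k\ge 2$, then in each round $$\mathrm{wl}_{i+1}(\bar v)=\Big(\mathrm{wl}_i(\bar v),\ \{\!\!\{(\mathrm{wl}_i(\bar v[w/1]),\dots,\mathrm{wl}_i(\bar v[w/k]))\mid w\in V(G)\}\!\!\}\Big),$$ where $\bar v[w/j]$ is obtained from $\bar v$ by replacing the $j$-th entry with $w$; for $k=1$ the multiset is $\{\!\!\{\mathrm{wl}_i(w)\mid w\in N_G(v)\}\!\!\}$ instead. Let $i_\infty$ be the least $i$ such that $\mathrm{wl}_i$ and $\mathrm{wl}_{i+1}$ induce the same partition of $V(G)^k$; the output of $k$-WL is the coloring $\mathrm{wl}_{i_\infty+1}$. $k$-WL distinguishes two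 colored graphs if the multisets of colors of all $k$-tuples in the two outputs differ, and it identifies $(G,\chi)$ if it distinguishes $(G,\chi)$ from every vertex-colored graph that is not isomorphic to it (isomorphisms preserve colors). The WL dimension of $(G,\chi)$ is the least $k\ge 1$ such that $k$-WL identifies $(G,\chi)$. Theorem. There is a function $f\colon\mathbb N\to\mathbb R$ with $f(n)=o(n)$ as $n\to\infty$ such that every vertex-colored graph $(G,\chi)$ with $n$ vertices has (finite) WL dimension at most $\frac n4+f(n)$. In particular, every $n$-vertex graph has WL dimension at most $\frac n4+o(n)$. -/

import Mathlib

open Filter Asymptotics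

universe u v

namespace WL

/-- The isomorphism type of an ordered `k`-tuple of vertices of a colored graph: the colors of the
entries, which entries coincide, and which entries are adjacent. -/
abbrev AtomicType (k : ℕ) (C : Type v) : Type v :=
  (Fin k → C) × (Fin k → Fin k → Prop) × (Fin k → Fin k → Prop)

/-- The colors available after `i` rounds of `k`-WL. They do not depend on the graph, so that
colors of tuples of different graphs can be compared. -/
def Color (k : ℕ) (C : Type v) : ℕ → Type v
  | 0 => AtomicType k C
  | i + 1 => Color k C i × Multiset (Fin k → Color k C i)

section

variable {V : Type u} {C : Type v}

/-- The isomorphism type of the tuple `x` in the colored graph `(G, χ)`. -/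
def atomicType {k : ℕ} (G : SimpleGraph V) (χ : V → C) (x : Fin k → V) : AtomicType k C :=
  (fun i => χ (x i), fun i j => x i = x j, fun i j => G.Adj (x i) (x j))

/-- Two tuples have the same atomic type iff mapping one to the other entry by entry is an
isomorphism between the induced colored subgraphs. -/
theorem atomicType_eq_iff {W : Type u} {k : ℕ} (G : SimpleGraph V) (χ : V → C)
    (H : SimpleGraph W) (ψ : W → C) (x : Fin k → V) (y : Fin k → W) :
    atomicType G χ x = atomicType H ψ y ↔
      ∃ e : G.induce (Set.range x) ≃g H.induce (Set.range y),
        (∀ i, (e ⟨x i, Set.mem_range_self i⟩ : W) = y i) ∧ ∀ z, ψ (e z) = χ z := by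
  constructor
  · intro h
    simp only [atomicType, Prod.mk.injEq, funext_iff, eq_iff_iff] at h
    obtain ⟨h1, h2, h3⟩ := h
    choose p hp using fun z : Set.range x => z.2
    choose q hq using fun z : Set.range y => z.2
    refine ⟨⟨⟨fun z => ⟨y (p z), Set.mem_range_self _⟩, fun z => ⟨x (q z), Set.mem_range_self _⟩,
      ?_, ?_⟩, ?_⟩, ?_, ?_⟩
    · intro z
      apply Subtype.ext
      change x (q _) = z
      rw [← hp z, h2]
      exact hq ⟨y (p z), Set.mem_range_self _⟩
    · intro z
      apply Subtype.ext
      change y (p _) = z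
      rw [← hq z, ← h2]
      exact hp ⟨x (q z), Set.mem_range_self _⟩
    · intro a b
      change H.Adj (y (p a)) (y (p b)) ↔ G.Adj a b
      rw [← h3, hp, hp]
    · intro i
      change y (p _) = y i
      rw [← h2]
      exact hp ⟨x i, Set.mem_range_self i⟩
    · intro z
      change ψ (y (p z)) = χ z
      rw [← h1, hp]
  · rintro ⟨e, he, hc⟩
    simp only [atomicType, Prod.mk.injEq, funext_iff, eq_iff_iff]
    refine ⟨fun i => ?_, fun i j => ?_, fun i j => ?_⟩
    · rw [← he, hc]
    · rw [← he i, ← he j, ← Subtype.ext_iff, e.injective.eq_iff, Subtype.mk.injEq]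
    · rw [← he i, ← he j]
      exact (e.map_rel_iff (a := ⟨x i, Set.mem_range_self i⟩)
        (b := ⟨x j, Set.mem_range_self j⟩)).symm

/-- `c₁` refines `c₂`. -/
def Refines {T A B : Type*} (c₁ : T → A) (c₂ : T → B) : Prop :=
  ∀ s t, c₁ s = c₁ t → c₂ s = c₂ t

/-- The two colorings induce the same partition. -/
def Equivalent {T A B : Type*} (c₁ : T → A) (c₂ : T → B) : Prop :=
  Refines c₁ c₂ ∧ Refines c₂ c₁

variable [Fintype V]

open Classical in
/-- The vertices that are substituted into the tuple `x` in one round of `k`-WL: all vertices,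
except that for `k = 1` only the neighbors of the single entry of `x` are considered. -/
noncomputable def substitutes {k : ℕ} (G : SimpleGraph V) (x : Fin k → V) : Finset V :=
  if k = 1 then Finset.univ.filter (fun w => ∀ j, G.Adj (x j) w) else Finset.univ

/-- The coloring of `k`-tuples computed by `i` rounds of `k`-WL on `(G, χ)`. -/
noncomputable def roundColoring (k : ℕ) (G : SimpleGraph V) (χ : V → C) :
    (i : ℕ) → (Fin k → V) → Color k C i
  | 0, x => atomicType G χ x
  | i + 1, x =>
    (roundColoring k G χ i x,
      (substitutes G x).val.map fun w => fun j => roundColoring k G χ i (Function.update x j w))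

/-- The least `i` such that round `i + 1` does not properly refine round `i`. -/
noncomputable def stableRound (k : ℕ) (G : SimpleGraph V) (χ : V → C) : ℕ :=
  sInf {i | Equivalent (roundColoring k G χ i) (roundColoring k G χ (i + 1))}

/-- The set in the definition of `stableRound` is nonempty. -/
theorem exists_stableRound (k : ℕ) (G : SimpleGraph V) (χ : V → C) :
    {i | Equivalent (roundColoring k G χ i) (roundColoring k G χ (i + 1))}.Nonempty := by
  classical
  let S : ℕ → Set ((Fin k → V) × (Fin k → V)) :=
    fun i => {p | roundColoring k G χ i p.1 = roundColoring k G χ i p.2}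
  have hS : ∀ i, S (i + 1) ⊆ S i := fun i p hp => congrArg Prod.fst hp
  obtain ⟨n, hn⟩ := WellFoundedGT.monotone_chain_condition
    (α := (Set ((Fin k → V) × (Fin k → V)))ᵒᵈ)
    ⟨fun i => OrderDual.toDual (S i), monotone_nat_of_le_succ fun i => hS i⟩
  have h : S n = S (n + 1) := hn (n + 1) (Nat.le_succ n)
  exact ⟨n, fun s t hst => (Set.ext_iff.1 h (s, t)).1 hst,
    fun s t hst => (Set.ext_iff.1 h (s, t)).2 hst⟩

/-- The coloring of `k`-tuples computed by `k`-WL on `(G, χ)`. -/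
noncomputable def coloring (k : ℕ) (G : SimpleGraph V) (χ : V → C) (x : Fin k → V) :
    Σ i, Color k C i :=
  ⟨stableRound k G χ + 1, roundColoring k G χ (stableRound k G χ + 1) x⟩

/-- `k`-WL distinguishes the colored graphs `(G, χ)` and `(H, ψ)`. -/
def Distinguishes (k : ℕ) (G : SimpleGraph V) (χ : V → C)
    {W : Type u} [Fintype W] (H : SimpleGraph W) (ψ : W → C) : Prop :=
  (Finset.univ : Finset (Fin k → V)).val.map (coloring k G χ) ≠
    (Finset.univ : Finset (Fin k → W)).val.map (coloring k H ψ)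

/-- `k`-WL identifies the colored graph `(G, χ)`: it distinguishes it from every colored graph
that is not isomorphic to it. -/
def Identifies (k : ℕ) (G : SimpleGraph V) (χ : V → C) : Prop :=
  ∀ (W : Type u) [Fintype W] [Nonempty W] (H : SimpleGraph W) (ψ : W → C),
    (¬ ∃ φ : G ≃g H, ∀ x, ψ (φ x) = χ x) → Distinguishes k G χ H ψ

/-- The Weisfeiler–Leman dimension of `(G, χ)`: the least `k ≥ 1` such that `k`-WL identifies
`(G, χ)` (and `⊤` if there were none). -/
noncomputable def dimension (G : SimpleGraph V) (χ : V → C) : ℕ∞ :=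
  sInf {d : ℕ∞ | ∃ k : ℕ, d = k ∧ 1 ≤ k ∧ Identifies k G χ}

end

end WL

/-!
If `k`-WL does not distinguish two colored graphs, then Duplicator wins the bijective game with `k`
pebble pairs on the complete digraphs whose pairs are colored by their atomic types. Individualizing
a vertex costs one pebble, and passing to the coherent closure is free. As long as some set `S` of
vertices can be individualized so that at least `4 * |S|` new fibers appear, do so: there are at
most `n` fibers, so this costs at most `n / 4` pebbles.

Once no such `S` exists, a fiber is linked to at most two others, and by Fisher's inequality no path
of four distinct fibers is linked consecutively. Hence the linked fibers form clusters of at most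
three, and it suffices to identify each cluster. There, the discrepancies (the numbers of vertices
adjacent to exactly one of two vertices of the same fiber) take at most 12 values, so with
`T ≈ 2 * log n` one of the first 13 intervals between consecutive scales `T ^ 10 ^ (i + 1)` contains
none of them. A random set of `o(n)` vertices that hits all large discrepancies leaves only small
ones after individualization, so complementing the edges between densely joined fibers yields a
sparse graph. Vertices of high eccentricity that are far apart would create many new fibers by
their distance layers, so the components of this graph have size `o(n)`, and `o(n)` pebbles suffice
to identify them.
-/

namespace Rainbow

section Games

variable {V W X : Type u} {K K' : Type v} {k : ℕ}
variable {c : V → V → K} {d : W → W → K} {γ : K → Prop}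

/-- Isomorphism of edge-colored complete digraphs up to coarsening: only the colors of vertices,
i.e. of diagonal pairs, and the binary relation `γ` on the colors of pairs have to be preserved. -/
def Similar (γ : K → Prop) (c : V → V → K) (d : W → W → K) : Prop :=
  ∃ φ : V ≃ W, (∀ u, d (φ u) (φ u) = c u u) ∧ ∀ u v, γ (d (φ u) (φ v)) ↔ γ (c u v)

theorem Similar.symm (h : Similar γ c d) : Similar γ d c := by
  obtain ⟨φ, hdiag, hγ⟩ := h
  refine ⟨φ.symm, fun u => ?_, fun u v => ?_⟩
  · rw [← hdiag, φ.apply_symm_apply]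
  · rw [← hγ, φ.apply_symm_apply, φ.apply_symm_apply]

theorem Similar.trans {e : X → X → K} (h : Similar γ c d) (h' : Similar γ d e) :
    Similar γ c e := by
  obtain ⟨φ, hdiag, hγ⟩ := h
  obtain ⟨ψ, hdiag', hγ'⟩ := h'
  exact ⟨φ.trans ψ, fun u => (hdiag' _).trans (hdiag u), fun u v => (hγ' _ _).trans (hγ u v)⟩

/-- A back-and-forth system of positions of the bijective game with `k` pebble pairs, played on
two edge-colored complete digraphs. -/
structure IsBisim (k : ℕ) (c : V → V → K) (d : W → W → K)
    (R : (Fin k → V) → (Fin k → W) → Prop) : Prop where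
  color : ∀ x y, R x y → ∀ i j, c (x i) (x j) = d (y i) (y j)
  eq : ∀ x y, R x y → ∀ i j, x i = x j ↔ y i = y j
  step : ∀ x y, R x y → ∃ σ : V ≃ W, ∀ w i,
    R (Function.update x i w) (Function.update y i (σ w))

/-- Duplicator wins the bijective game with `k` pebble pairs. -/
def PebbleEquiv (k : ℕ) (c : V → V → K) (d : W → W → K) : Prop :=
  ∃ R, IsBisim k c d R ∧ ∃ x y, R x y

/-- Every structure that the `k`-pebble game cannot tell apart from `c` is isomorphic to `c`, up
to the coarsening in `Similar`. -/
def Identified (k : ℕ) (c : V → V → K) (γ : K → Prop) : Prop :=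
  ∀ (W : Type u) (d : W → W → K), PebbleEquiv k c d → Similar γ c d

section Bisim

variable {R : (Fin k → V) → (Fin k → W) → Prop} {x : Fin k → V} {y : Fin k → W}

theorem IsBisim.flip (h : IsBisim k c d R) : IsBisim k d c (fun y x => R x y) where
  color y x hR i j := (h.color x y hR i j).symm
  eq y x hR i j := (h.eq x y hR i j).symm
  step y x hR := by
    obtain ⟨σ, hσ⟩ := h.step x y hR
    exact ⟨σ.symm, fun w i => by simpa only [σ.apply_symm_apply] using hσ (σ.symm w) i⟩

theorem IsBisim.exists_partner (h : IsBisim k c d R) (hR : R x y) (x' : Fin k → V) :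
    ∃ y', R x' y' := by
  have key : ∀ s : Finset (Fin k), ∃ y', R (s.piecewise x' x) y' := by
    intro s
    induction s using Finset.induction_on with
    | empty => exact ⟨y, by rwa [Finset.piecewise_empty]⟩
    | insert i s _ ih =>
      obtain ⟨y', hy'⟩ := ih
      obtain ⟨σ, hσ⟩ := h.step _ _ hy'
      exact ⟨_, by rw [Finset.piecewise_insert]; exact hσ (x' i) i⟩
  simpa only [Finset.piecewise_univ] using key Finset.univ

theorem IsBisim.update (h : IsBisim k c d R) (hR : R x y) (i j : Fin k) :
    R (Function.update x i (x j)) (Function.update y i (y j)) := by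
  obtain rfl | hij := eq_or_ne j i
  · rwa [Function.update_eq_self, Function.update_eq_self]
  · obtain ⟨σ, hσ⟩ := h.step x y hR
    have hσj : σ (x j) = y j := by
      simpa [Function.update_of_ne hij] using h.eq _ _ (hσ (x j) i) i j
    exact hσj ▸ hσ (x j) i

theorem IsBisim.const (h : IsBisim k c d R) (hR : R x y) (j : Fin k) :
    R (fun _ => x j) (fun _ => y j) := by
  have key : ∀ s : Finset (Fin k),
      R (s.piecewise (fun _ => x j) x) (s.piecewise (fun _ => y j) y) := by
    intro s
    induction s using Finset.induction_on with
    | empty => simpa only [Finset.piecewise_empty]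
    | insert i s _ ih =>
      rw [Finset.piecewise_insert, Finset.piecewise_insert]
      simpa [Finset.piecewise] using h.update ih i j
  simpa only [Finset.piecewise_univ] using key Finset.univ

end Bisim

theorem PebbleEquiv.exists_triple (hk : 3 ≤ k) (h : PebbleEquiv k c d) (b : Fin 3 → W) :
    ∃ a : Fin 3 → V, ∀ i j, c (a i) (a j) = d (b i) (b j) := by
  obtain ⟨R, hR, x, y, hxy⟩ := h
  obtain ⟨x', hx'⟩ := hR.flip.exists_partner hxy (fun i : Fin k => b ⟨min i 2, by omega⟩)
  have hb : ∀ i : Fin 3, b ⟨min (Fin.castLE hk i) 2, by omega⟩ = b i := fun i =>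
    congrArg b (Fin.ext (by simp only [Fin.val_castLE]; omega))
  refine ⟨fun i => x' (Fin.castLE hk i), fun i j => ?_⟩
  rw [hR.color _ _ hx', hb, hb]

theorem PebbleEquiv.comp (h : PebbleEquiv k c d) (π : K → K') :
    PebbleEquiv k (fun u v => π (c u v)) (fun u v => π (d u v)) := by
  obtain ⟨R, hR, hne⟩ := h
  exact ⟨R, ⟨fun x y hxy i j => congrArg π (hR.color x y hxy i j), hR.eq, hR.step⟩, hne⟩

/-- The coloring `c` with the vertex `v` individualized. -/
def mark (c : V → V → K) (v : V) : V → V → K × Prop × Prop :=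
  fun u w => (c u w, u = v, w = v)

/-- One round of 2-dimensional refinement. -/
noncomputable def refine (c : V → V → K) : V → V → K × K × (K → K → ℕ) :=
  fun u v => (c u v, c v u, fun a b => Nat.card {w // c u w = a ∧ c w v = b})

-- One pebble pair is left on `v` and `w` forever.
theorem PebbleEquiv.mark (h : PebbleEquiv (k + 1) c d) (v : V) :
    ∃ w, PebbleEquiv k (mark c v) (mark d w) := by
  obtain ⟨R, hR, x, y, hxy⟩ := h
  obtain ⟨y, hy⟩ := hR.exists_partner hxy (fun _ => v)
  refine ⟨y 0, fun x z => R (Fin.cons v x) (Fin.cons (y 0) z), ⟨?_, ?_, ?_⟩, fun _ => v,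
    Fin.tail y, ?_⟩
  · intro x z hxz i j
    have hcolor := hR.color _ _ hxz i.succ j.succ
    have hi := hR.eq _ _ hxz i.succ 0
    have hj := hR.eq _ _ hxz j.succ 0
    simp only [Fin.cons_succ, Fin.cons_zero] at hcolor hi hj
    simp only [Rainbow.mark, hcolor, hi, hj]
  · intro x z hxz i j
    simpa only [Fin.cons_succ] using hR.eq _ _ hxz i.succ j.succ
  · intro x z hxz
    obtain ⟨σ, hσ⟩ := hR.step _ _ hxz
    exact ⟨σ, fun w i => by simpa only [Fin.cons_update] using hσ w i.succ⟩
  · convert hy using 1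
    · exact Fin.cons_self_tail (fun _ => v)
    · exact Fin.cons_self_tail y

theorem PebbleEquiv.of_succ [Nonempty V] (h : PebbleEquiv (k + 1) c d) : PebbleEquiv k c d := by
  obtain ⟨w, hw⟩ := h.mark (Classical.arbitrary V)
  exact hw.comp Prod.fst

theorem PebbleEquiv.refine (hk : 3 ≤ k) (h : PebbleEquiv k c d) :
    PebbleEquiv k (refine c) (refine d) := by
  obtain ⟨R, hR, hne⟩ := h
  refine ⟨R, ⟨fun x y hxy i j => ?_, hR.eq, hR.step⟩, hne⟩
  obtain ⟨l, hl⟩ : ∃ l, l ∉ ({i, j} : Finset (Fin k)) :=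
    Finset.exists_mem_notMem_of_card_lt_card (t := Finset.univ)
      (by simpa using Finset.card_le_two.trans_lt hk) |>.imp fun _ => And.right
  simp only [Finset.mem_insert, Finset.mem_singleton, not_or] at hl
  obtain ⟨σ, hσ⟩ := hR.step x y hxy
  have hleft : ∀ w, c (x i) w = d (y i) (σ w) := fun w => by
    simpa [Function.update_of_ne (Ne.symm hl.1)] using hR.color _ _ (hσ w l) i l
  have hright : ∀ w, c w (x j) = d (σ w) (y j) := fun w => by
    simpa [Function.update_of_ne (Ne.symm hl.2)] using hR.color _ _ (hσ w l) l j
  simp only [Rainbow.refine, Prod.mk.injEq]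
  refine ⟨hR.color x y hxy i j, hR.color x y hxy j i, funext fun a => funext fun b => ?_⟩
  exact Nat.card_congr (σ.subtypeEquiv fun w => by rw [hleft, hright])

theorem Identified.mono [Nonempty V] {l : ℕ} (h : Identified k c γ) (hkl : k ≤ l) :
    Identified l c γ := by
  induction l, hkl using Nat.le_induction with
  | base => exact h
  | succ l _ ih => exact fun W d hd => ih W d hd.of_succ

theorem Identified.of_mark (v : V) (h : Identified k (mark c v) (fun a => γ a.1)) :
    Identified (k + 1) c γ := by
  intro W d hd
  obtain ⟨w, hw⟩ := hd.mark v
  obtain ⟨φ, hdiag, hγ⟩ := h W _ hw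
  exact ⟨φ, fun u => congrArg Prod.fst (hdiag u), hγ⟩

theorem Identified.of_card_le [Finite V] [Nonempty V] (hk : Nat.card V ≤ k) :
    Identified k c γ := by
  rintro W d ⟨R, hR, x, y, hxy⟩
  obtain ⟨x, hx⟩ : ∃ x : Fin k → V, Function.Surjective x := by
    obtain ⟨e⟩ : Nonempty (V ↪ Fin k) := by
      have := Fintype.ofFinite V
      exact Function.Embedding.nonempty_of_card_le (by simpa using hk)
    exact ⟨Function.invFun e, Function.invFun_surjective e.injective⟩
  obtain ⟨y, hy⟩ := hR.exists_partner hxy x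
  obtain ⟨σ, -⟩ := hR.step _ _ hy
  have : Finite W := Finite.of_equiv V σ
  choose g hg using hx
  have hinj : Function.Injective fun v => y (g v) := fun a b hab => by
    simpa only [hg] using (hR.eq _ _ hy (g a) (g b)).2 hab
  let φ : V ≃ W := Equiv.ofBijective _
    (hinj.bijective_of_nat_card_le (Nat.card_congr σ).ge)
  have hc : ∀ u v, d (φ u) (φ v) = c u v := fun u v => by
    simpa [φ, hg] using (hR.color _ _ hy (g u) (g v)).symm
  exact ⟨φ, fun u => hc u u, fun u v => by rw [hc]⟩

end Games

section Coherent

variable {V : Type u} {K K' : Type v} {k : ℕ} {c : V → V → K}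

/-- The coloring `c'` refines `c`. -/
def Finer (c' : V → V → K') (c : V → V → K) : Prop :=
  ∀ u v x y, c' u v = c' x y → c u v = c x y

/-- A coherent configuration, given by the coloring whose color classes are its basis relations.
The field `perm` says that the intersection numbers are well defined. -/
structure Coherent (c : V → V → K) : Prop where
  diag : ∀ u v w, c u v = c w w → u = v
  symm : ∀ u v u' v', c u v = c u' v' → c v u = c v' u'
  perm : ∀ u v u' v', c u v = c u' v' →
    ∃ σ : V ≃ V, ∀ w, c u w = c u' (σ w) ∧ c w v = c (σ w) v'

theorem Coherent.left (hc : Coherent c) {u v u' v' : V} (h : c u v = c u' v') :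
    c u u = c u' u' := by
  obtain ⟨σ, hσ⟩ := hc.perm _ _ _ _ h
  have huu := (hσ u).1
  rw [huu, ← hc.diag _ _ _ huu.symm]

theorem Coherent.right (hc : Coherent c) {u v u' v' : V} (h : c u v = c u' v') :
    c v v = c v' v' :=
  hc.left (hc.symm _ _ _ _ h)

theorem coherent_of_finer_refine [Finite V] (hd : ∀ u v w, c u v = c w w → u = v)
    (h : Finer c (refine c)) : Coherent c where
  diag := hd
  symm u v u' v' huv := congrArg (fun a => a.2.1) (h u v u' v' huv)
  perm u v u' v' huv := by
    have hcard : ∀ a : K × K, Nat.card {w // (c u w, c w v) = a} =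
        Nat.card {w // (c u' w, c w v') = a} := by
      intro a
      simpa only [Prod.ext_iff, Rainbow.refine] using
        congrArg (fun r => r.2.2 a.1 a.2) (h u v u' v' huv)
    let e := fun a => (Finite.card_eq.1 (hcard a)).some
    refine ⟨Equiv.ofFiberEquiv e, fun w => ?_⟩
    have hw := Equiv.ofFiberEquiv_map e w
    rw [Prod.mk.injEq] at hw
    exact ⟨hw.1.symm, hw.2.symm⟩

theorem Finer.refine {c' : V → V → K'} (hc' : Coherent c') (h : Finer c' c) :
    Finer c' (refine c) := by
  intro u v u' v' huv
  obtain ⟨σ, hσ⟩ := hc'.perm _ _ _ _ huv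
  simp only [Rainbow.refine, Prod.mk.injEq]
  refine ⟨h _ _ _ _ huv, h _ _ _ _ (hc'.symm _ _ _ _ huv), funext fun a => funext fun b => ?_⟩
  exact Nat.card_congr (σ.subtypeEquiv fun w => by
    rw [h _ _ _ _ (hσ w).1, h _ _ _ _ (hσ w).2])

theorem Identified.of_refine {γ : K → Prop} (hk : 3 ≤ k)
    (h : Identified k (refine c) fun a => γ a.1) : Identified k c γ := by
  intro W d hd
  obtain ⟨φ, hdiag, hγ⟩ := h W _ (hd.refine hk)
  exact ⟨φ, fun u => congrArg Prod.fst (hdiag u), hγ⟩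

/-- Every vertex of `S` has a color of its own. -/
def Separates (c : V → V → K) (S : Finset V) : Prop :=
  ∀ s ∈ S, ∀ u, c u u = c s s → u = s

theorem Separates.eq_iff_eq {S : Finset V} (h : Separates c S) {s u v : V} (hs : s ∈ S)
    (huv : c u u = c v v) : u = s ↔ v = s :=
  ⟨fun hu => h s hs v (by rw [← huv, hu]), fun hv => h s hs u (by rw [huv, hv])⟩

/-- `c'` is the coarsest coherent refinement of `c` in which every vertex of `S` has a color of its
own, and `|S|` extra pebbles reduce the identification of `c` to that of `c'`. The map `π` recovers
the colors of `c` from those of `c'`. For `S = ∅` this is the coherent closure of `c`. -/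
structure IsIndividualization (c : V → V → K) (c' : V → V → K') (π : K' → K) (S : Finset V) :
    Prop where
  coherent : Coherent c'
  proj : ∀ u v, π (c' u v) = c u v
  separates : Separates c' S
  identified : ∀ k (γ : K → Prop), 3 ≤ k → Identified k c' (fun a => γ (π a)) →
    Identified (k + S.card) c γ
  coarsest : ∀ (K'' : Type v) (c'' : V → V → K''), Coherent c'' → Finer c'' c →
    Separates c'' S → Finer c'' c'

theorem IsIndividualization.finer {c' : V → V → K'} {π : K' → K} {S : Finset V}
    (h : IsIndividualization c c' π S) : Finer c' c := fun u v u' v' huv => by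
  rw [← h.proj, huv, h.proj]

theorem card_range_lt_card_range_refine [Finite V] (h : ¬ Finer c (refine c)) :
    (Set.range fun p : V × V => c p.1 p.2).ncard <
      (Set.range fun p : V × V => refine c p.1 p.2).ncard := by
  have hfin := Set.finite_range fun p : V × V => refine c p.1 p.2
  have himg : (Set.range fun p : V × V => c p.1 p.2) =
      Prod.fst '' (Set.range fun p : V × V => refine c p.1 p.2) :=
    Set.range_comp Prod.fst fun p : V × V => refine c p.1 p.2
  rw [himg]
  refine (Set.ncard_image_le hfin).lt_of_ne fun heq => h fun u v u' v' huv => ?_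
  exact Set.injOn_of_ncard_image_eq heq hfin ⟨(u, v), rfl⟩ ⟨(u', v'), rfl⟩ huv

theorem exists_coherent_closure [Finite V] (hd : ∀ u v w, c u v = c w w → u = v) :
    ∃ (K' : Type v) (c' : V → V → K') (π : K' → K), IsIndividualization c c' π ∅ := by
  induction hm : Nat.card (V × V) - (Set.range fun p : V × V => c p.1 p.2).ncard
    using Nat.strong_induction_on generalizing K c with | _ m ih
  by_cases h : Finer c (refine c)
  · exact ⟨K, c, id, coherent_of_finer_refine hd h, fun _ _ => rfl, by simp [Separates],
      fun k γ _ hI => hI, fun _ _ _ hf _ => hf⟩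
  · have hlt := card_range_lt_card_range_refine h
    have hle : (Set.range fun p : V × V => refine c p.1 p.2).ncard ≤ Nat.card (V × V) :=
      Finite.card_range_le _
    obtain ⟨K', c', π, hc'⟩ := ih _ (by omega) (c := refine c)
      (fun u v w huv => hd u v w (congrArg Prod.fst huv)) rfl
    exact ⟨K', c', fun a => (π a).1, hc'.coherent, fun u v => congrArg Prod.fst (hc'.proj u v),
      hc'.separates, fun k γ hk hI => (hc'.identified k _ hk hI).of_refine hk,
      fun K'' c'' h'' hf hs => hc'.coarsest K'' c'' h'' (hf.refine h'') hs⟩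

theorem IsIndividualization.insert [DecidableEq V] {K'' : Type v} {c' : V → V → K'} {π : K' → K}
    {S : Finset V} {v : V} {c'' : V → V → K''} {π' : K'' → K' × Prop × Prop}
    (h : IsIndividualization c c' π S) (h' : IsIndividualization (mark c' v) c'' π' ∅)
    (hv : v ∉ S) : IsIndividualization c c'' (fun a => π (π' a).1) (insert v S) where
  coherent := h'.coherent
  proj a b := (congrArg (fun r => π r.1) (h'.proj a b)).trans (h.proj a b)
  separates s hs u hu := by
    have hmark := h'.finer _ _ _ _ hu
    simp only [mark, Prod.mk.injEq] at hmark
    obtain rfl | hs := Finset.mem_insert.1 hs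
    · exact hmark.2.1.mpr rfl
    · exact h.separates s hs u hmark.1
  identified k γ hk hI := by
    rw [Finset.card_insert_of_notMem hv, ← Nat.add_assoc, Nat.add_right_comm]
    exact h.identified (k + 1) γ (by omega) (h'.identified k _ hk hI).of_mark
  coarsest K₀ c₀ h₀ hf hs := by
    refine h'.coarsest K₀ c₀ h₀ (fun a b a' b' hab => ?_) (by simp [Separates])
    have hv := Finset.mem_insert_self v S
    simp only [mark, Prod.mk.injEq]
    exact ⟨h.coarsest K₀ c₀ h₀ hf (fun s h => hs s (Finset.mem_insert_of_mem h)) _ _ _ _ hab,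
      propext (hs.eq_iff_eq hv (h₀.left hab)), propext (hs.eq_iff_eq hv (h₀.right hab))⟩

theorem exists_individualization [Finite V] (hd : ∀ u v w, c u v = c w w → u = v)
    (S : Finset V) :
    ∃ (K' : Type v) (c' : V → V → K') (π : K' → K), IsIndividualization c c' π S := by
  classical
  induction S using Finset.induction_on with
  | empty => exact exists_coherent_closure hd
  | insert v S hv ih =>
    obtain ⟨K₁, c₁, π₁, h₁⟩ := ih
    obtain ⟨K₂, c₂, π₂, h₂⟩ := exists_coherent_closure (c := mark c₁ v)
      (fun u w z h => h₁.coherent.diag u w z (congrArg Prod.fst h))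
    exact ⟨K₂, c₂, _, h₁.insert h₂ hv⟩

end Coherent

section Components

theorem card_subtype_comp {α A : Type*} [Finite α] [Finite A] {f : α → A} {p : A → Prop} {n : ℕ}
    (h : ∀ x, p x → Nat.card {a // f a = x} = n) :
    Nat.card {a // p (f a)} = Nat.card {x // p x} * n := by
  have := Fintype.ofFinite {x // p x}
  rw [← Nat.card_congr (Equiv.sigmaSubtypeFiberEquivSubtype f fun _ => Iff.rfl), Nat.card_sigma,
    Finset.sum_congr rfl fun (x : {x // p x}) _ => h x x.2, Finset.sum_const, Finset.card_univ,
    Nat.card_eq_fintype_card, smul_eq_mul]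

/-- The bases have equally many points of each type `t`: divide the number of points of type `t`
in the total spaces by the common size of the fibers. -/
theorem exists_base_equiv {V W A B T : Type*} [Finite V] [Finite W] {f : V → A} {g : W → B}
    (hf : Function.Surjective f) (hg : Function.Surjective g) (σ : V ≃ W) {t : V → T}
    (htf : ∀ a b, f a = f b → t a = t b) (htg : ∀ a b, g (σ a) = g (σ b) → t a = t b)
    (hcard : ∀ a b, t a = t b → Nat.card {x // f x = f a} = Nat.card {y // g y = g (σ b)}) :
    ∃ e : A ≃ B, ∀ a b, e (f a) = g (σ b) → t a = t b := by
  have := Finite.of_surjective f hf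
  have := Finite.of_surjective g hg
  let tA : A → T := fun x => t (Function.surjInv hf x)
  let tB : B → T := fun y => t (σ.symm (Function.surjInv hg y))
  have htA : ∀ a, tA (f a) = t a := fun a => htf _ _ (Function.surjInv_eq hf _)
  have htB : ∀ b, tB (g (σ b)) = t b := fun b => htg _ _ (by simp [Function.surjInv_eq hg])
  have hequiv : ∀ τ, Nonempty ({x // tA x = τ} ≃ {y // tB y = τ}) := by
    intro τ
    by_cases hτ : ∃ a, t a = τ
    · obtain ⟨a, rfl⟩ := hτ
      let n := Nat.card {x // f x = f a}
      have hA : ∀ x, tA x = t a → Nat.card {v // f v = x} = n := fun x hx => by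
        obtain ⟨b, rfl⟩ := hf x
        rw [hcard b a (by rw [← hx, htA]), ← hcard a a rfl]
      have hB : ∀ y, tB y = t a → Nat.card {w // g w = y} = n := fun y hy => by
        obtain ⟨w, rfl⟩ := hg y
        obtain ⟨b, rfl⟩ := σ.surjective w
        exact (hcard a b (by rw [← hy, htB])).symm
      have hn : 0 < n := @Nat.card_pos _ ⟨⟨a, rfl⟩⟩ _
      refine Finite.card_eq.1 (Nat.eq_of_mul_eq_mul_right hn ?_)
      rw [← card_subtype_comp hA, ← card_subtype_comp hB]
      exact Nat.card_congr (σ.subtypeEquiv fun b => by rw [htA, htB])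
    · have : IsEmpty {x // tA x = τ} := ⟨fun x => hτ ⟨_, x.2⟩⟩
      have : IsEmpty {y // tB y = τ} := ⟨fun y => hτ ⟨_, y.2⟩⟩
      exact ⟨Equiv.equivOfIsEmpty _ _⟩
  refine ⟨Equiv.ofFiberEquiv fun τ => (hequiv τ).some, fun a b hab => ?_⟩
  rw [← htA, ← htB, ← hab]
  exact (Equiv.ofFiberEquiv_map (g := tB) _ _).symm

variable {V W : Type u} {K : Type v} {k : ℕ} {c : V → V → K} {d : W → W → K} {γ : K → Prop}

/-- The coloring induced on the vertices satisfying `P`. -/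
def restrict (c : V → V → K) (P : V → Prop) : {v // P v} → {v // P v} → K :=
  fun u v => c u v

theorem Similar.restrict_congr {P Q : V → Prop} (h : ∀ v, P v ↔ Q v) :
    Similar γ (restrict c P) (restrict c Q) :=
  ⟨Equiv.subtypeEquivRight h, fun _ => rfl, fun _ _ => Iff.rfl⟩

theorem exists_equiv_of_similar_fibers {A : Type*} {f : V → A} {g : W → A}
    (h : ∀ P, Similar γ (restrict c fun v => f v = P) (restrict d fun w => g w = P)) :
    ∃ φ : V ≃ W, (∀ u, d (φ u) (φ u) = c u u) ∧ (∀ u, g (φ u) = f u) ∧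
      ∀ u v, f u = f v → (γ (d (φ u) (φ v)) ↔ γ (c u v)) := by
  choose ε hdiag hγ using h
  have hφ : ∀ v P (h : f v = P), Equiv.ofFiberEquiv ε v = ε P ⟨v, h⟩ := by
    rintro v P rfl
    rfl
  refine ⟨Equiv.ofFiberEquiv ε, fun u => ?_, Equiv.ofFiberEquiv_map ε, fun u v huv => ?_⟩
  · rw [hφ u _ rfl]
    exact hdiag _ _
  · rw [hφ u _ huv, hφ v _ rfl]
    exact hγ _ _ _

variable {E : K → Prop}

theorem PebbleEquiv.equivalence (hk : 3 ≤ k) (h : PebbleEquiv k c d)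
    (hE : Equivalence fun u v => E (c u v)) : Equivalence fun a b => E (d a b) where
  refl a := by
    obtain ⟨x, hx⟩ := h.exists_triple hk fun _ => a
    exact hx 0 0 ▸ hE.refl _
  symm {a b} hab := by
    obtain ⟨x, hx⟩ := h.exists_triple hk ![a, b, b]
    exact hx 1 0 ▸ hE.symm (hx 0 1 ▸ hab)
  trans {a b e} hab hbe := by
    obtain ⟨x, hx⟩ := h.exists_triple hk ![a, b, e]
    exact hx 0 2 ▸ hE.trans (y := x 1) (hx 0 1 ▸ hab) (hx 1 2 ▸ hbe)

theorem IsBisim.restrict {R : (Fin k → V) → (Fin k → W) → Prop} (hk : 2 ≤ k)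
    (hR : IsBisim k c d R) (hE : Equivalence fun u v => E (c u v))
    (hE' : Equivalence fun a b => E (d a b)) {p : V} {q : W} (hpq : R (fun _ => p) fun _ => q) :
    PebbleEquiv k (restrict c fun v => E (c p v)) (restrict d fun b => E (d q b)) := by
  refine ⟨fun x y => R (fun i => x i) fun i => y i, ⟨fun x y hxy => hR.color _ _ hxy,
    fun x y hxy i j => ?_, fun x y hxy => ?_⟩, fun _ => ⟨p, hE.refl p⟩, fun _ => ⟨q, hE'.refl q⟩,
    hpq⟩
  · rw [Subtype.ext_iff, Subtype.ext_iff]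
    exact hR.eq _ _ hxy i j
  · obtain ⟨σ, hσ⟩ := hR.step _ _ hxy
    let i₀ : Fin k := ⟨0, by omega⟩
    let i₁ : Fin k := ⟨1, by omega⟩
    have hne : i₀ ≠ i₁ := by simp [i₀, i₁]
    have hmem : ∀ w, E (c p w) ↔ E (d q (σ w)) := fun w => by
      have hcolor : c (x i₀) w = d (y i₀) (σ w) := by
        simpa [Function.update_of_ne hne] using hR.color _ _ (hσ w i₁) i₀ i₁
      exact ⟨fun h => hE'.trans (y i₀).2 (hcolor ▸ hE.trans (hE.symm (x i₀).2) h),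
        fun h => hE.trans (x i₀).2 (hcolor ▸ hE'.trans (hE'.symm (y i₀).2) h)⟩
    refine ⟨σ.subtypeEquiv hmem, fun w i => ?_⟩
    have hcoe : ∀ {α : Type u} {p : α → Prop} (z : Fin k → {a // p a}) (a : {a // p a}),
        (fun j => (Function.update z i a j : α)) = Function.update (fun j => (z j : α)) i a :=
      fun z a => funext fun j => Function.apply_update (fun _ => Subtype.val) z i a j
    rw [hcoe, hcoe]
    exact hσ w i

theorem PebbleEquiv.exists_equiv_similar_components (hk : 3 ≤ k) (h : PebbleEquiv k c d)
    (hE : Equivalence fun u v => E (c u v))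
    (hI : ∀ p, Identified k (Rainbow.restrict c fun v => E (c p v)) γ) :
    ∃ σ : V ≃ W, ∀ p, Similar γ (Rainbow.restrict c fun v => E (c p v))
      (Rainbow.restrict d fun b => E (d (σ p) b)) := by
  have hE' := h.equivalence hk hE
  obtain ⟨R, hR, x, y, hxy⟩ := h
  obtain ⟨σ, hσ⟩ := hR.step _ _ hxy
  let i₀ : Fin k := ⟨0, by omega⟩
  have hconst : ∀ p, R (fun _ => p) fun _ => σ p := fun p => by
    simpa only [Function.update_self] using hR.const (hσ p i₀) i₀
  exact ⟨σ, fun p => hI p _ _ (hR.restrict (by omega) hE hE' (hconst p))⟩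

theorem exists_equiv_of_similar_components [Finite V]
    (hE : Equivalence fun u v => E (c u v)) (hE' : Equivalence fun a b => E (d a b)) (σ : V ≃ W)
    (hσ : ∀ p, Similar γ (restrict c fun v => E (c p v)) (restrict d fun b => E (d (σ p) b))) :
    ∃ φ : V ≃ W, (∀ u, d (φ u) (φ u) = c u u) ∧ (∀ u v, E (d (φ u) (φ v)) ↔ E (c u v)) ∧
      ∀ u v, E (c u v) → (γ (d (φ u) (φ v)) ↔ γ (c u v)) := by
  have : Finite W := Finite.of_equiv V σ
  let r : Setoid V := ⟨_, hE⟩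
  let r' : Setoid W := ⟨_, hE'⟩
  have hr : ∀ {p v}, Quotient.mk r v = Quotient.mk r p ↔ E (c p v) := fun {_ _} =>
    Quotient.eq.trans ⟨hE.symm, hE.symm⟩
  have hr' : ∀ {q b}, Quotient.mk r' b = Quotient.mk r' q ↔ E (d q b) := fun {_ _} =>
    Quotient.eq.trans ⟨hE'.symm, hE'.symm⟩
  let s : Setoid V := ⟨fun p p' => Similar γ (restrict c fun v => E (c p v))
    (restrict c fun v => E (c p' v)),
    fun _ => .restrict_congr fun _ => Iff.rfl, Similar.symm, Similar.trans⟩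
  obtain ⟨e, he⟩ := exists_base_equiv (f := Quotient.mk r) (g := Quotient.mk r')
    (t := Quotient.mk s) Quotient.mk_surjective Quotient.mk_surjective σ
    (fun a b hab => Quotient.sound <| .restrict_congr fun v => by rw [← hr, ← hr, hab])
    (fun a b hab => Quotient.sound <| ((hσ a).trans
      (.restrict_congr fun v => by rw [← hr', ← hr', hab])).trans (hσ b).symm)
    (fun a b hab => by
      obtain ⟨φ, -⟩ := (Quotient.exact hab : Similar γ _ _).trans (hσ b)
      simp only [hr, hr']
      exact Nat.card_congr φ)
  obtain ⟨φ, hdiag, hmk, hγ⟩ := exists_equiv_of_similar_fibers (c := c) (d := d) (γ := γ)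
    (f := Quotient.mk r) (g := fun w => e.symm (Quotient.mk r' w)) fun P => by
      obtain ⟨p, rfl⟩ := Quotient.mk_surjective P
      obtain ⟨q, hq⟩ := Quotient.mk_surjective (e (Quotient.mk r p))
      obtain ⟨b, rfl⟩ := σ.surjective q
      have hpb : Similar γ _ _ := Quotient.exact (he p b hq.symm)
      refine (Similar.restrict_congr fun v => hr).trans ((hpb.trans (hσ b)).trans
        (.restrict_congr fun w => ?_))
      rw [e.symm_apply_eq, ← hq, hr']
  refine ⟨φ, hdiag, fun u v => ?_, fun u v huv => hγ u v (hr.2 huv).symm⟩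
  rw [← hr', ← e.symm.injective.eq_iff, hmk, hmk, hr]

theorem Identified.of_components [Finite V] (hk : 3 ≤ k) (E : K → Prop)
    (hE : Equivalence fun u v => E (c u v))
    (hdet : ∀ u v u' v', ¬ E (c u v) → ¬ E (c u' v') → c u u = c u' u' → c v v = c v' v' →
      (γ (c u v) ↔ γ (c u' v')))
    (hI : ∀ p, Identified k (restrict c fun v => E (c p v)) γ) : Identified k c γ := by
  intro W d h
  obtain ⟨σ, hσ⟩ := h.exists_equiv_similar_components hk hE hI
  obtain ⟨φ, hdiag, hφE, hφγ⟩ := exists_equiv_of_similar_components hE (h.equivalence hk hE) σ hσ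
  refine ⟨φ, hdiag, fun u v => ?_⟩
  by_cases huv : E (c u v)
  · exact hφγ u v huv
  · obtain ⟨x, hx⟩ := h.exists_triple hk ![φ u, φ v, φ v]
    have hφuv : c (x 0) (x 1) = d (φ u) (φ v) := hx 0 1
    rw [← hφuv]
    refine hdet _ _ _ _ (by rwa [hφuv, hφE]) huv ?_ ?_
    · exact (hx 0 0).trans (hdiag u)
    · exact (hx 1 1).trans (hdiag v)

end Components

section Fibers

theorem card_image_le_card_image {α A B : Type*} [DecidableEq A] [DecidableEq B] {s : Finset α}
    {f : α → A} {g : α → B} (h : ∀ a ∈ s, ∀ b ∈ s, g a = g b → f a = f b) :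
    (s.image f).card ≤ (s.image g).card := by
  obtain ⟨t, hts, hinj, ht⟩ := Finset.exists_subset_injOn_image_eq_of_surjOn (s : Set α)
    (s.image f) (by simpa using Set.surjOn_image f s)
  have hg : Set.InjOn g t := fun a ha b hb hab => hinj ha hb (h a (hts ha) b (hts hb) hab)
  rw [← ht, Finset.card_image_of_injOn hinj, ← Finset.card_image_of_injOn hg]
  exact Finset.card_le_card (Finset.image_subset_image hts)

variable {V : Type u} {K K' : Type v} {c : V → V → K} {c' : V → V → K'} {u v : V}

theorem Coherent.eq_of_separates (hc : Coherent c) {S : Finset V} (hS : Separates c S) {s : V}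
    (hs : s ∈ S) (h : c u u = c v v) : c u s = c v s := by
  obtain ⟨σ, hσ⟩ := hc.perm _ _ _ _ h
  have hcolor := (hσ s).1
  rwa [hS s hs (σ s) (hc.right hcolor).symm] at hcolor

theorem Finer.eq_of_separates (hc : Coherent c) (hc' : Coherent c') (hf : Finer c' c)
    {S : Finset V} (hS : Separates c' S) {s : V} (hs : s ∈ S) (h : c' u u = c' v v) :
    c s u = c s v :=
  hc.symm _ _ _ _ (hf _ _ _ _ (hc'.eq_of_separates hS hs h))

variable [Fintype V]

open scoped Classical in
/-- The fiber of `v`: the vertices of the same color as `v`. -/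
noncomputable def fiber (c : V → V → K) (v : V) : Finset V :=
  {u | c u u = c v v}

@[simp]
theorem mem_fiber : u ∈ fiber c v ↔ c u u = c v v := by
  simp [fiber]

open scoped Classical in
/-- The number of fibers, that is, of colors of vertices. -/
noncomputable def numFibers (c : V → V → K) : ℕ :=
  (Finset.univ.image fun u => c u u).card

open scoped Classical in
/-- The number of fibers of `c'` that the fiber of `v` under the coarser coloring `c` splits
into. -/
noncomputable def numSubfibers (c' : V → V → K') (c : V → V → K) (v : V) : ℕ :=
  ((fiber c v).image fun u => c' u u).card

open scoped Classical in
theorem Finer.numFibers_eq_sum (hf : Finer c' c) :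
    numFibers c' = ∑ κ ∈ Finset.univ.image fun u => c u u,
      ((Finset.univ.filter fun u => c u u = κ).image fun u => c' u u).card := by
  rw [← Finset.card_biUnion, numFibers]
  · congr 1
    ext κ
    simp only [Finset.mem_biUnion, Finset.mem_image, Finset.mem_filter]
    constructor
    · rintro ⟨w, hw, rfl⟩
      exact ⟨_, ⟨w, hw, rfl⟩, w, ⟨hw, rfl⟩, rfl⟩
    · rintro ⟨_, -, w, ⟨hw, -⟩, rfl⟩
      exact ⟨w, hw, rfl⟩
  · intro κ _ κ' _ hκκ'
    refine Finset.disjoint_left.2 fun a ha ha' => hκκ' ?_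
    simp only [Finset.mem_image, Finset.mem_filter] at ha ha'
    obtain ⟨⟨w, ⟨-, rfl⟩, rfl⟩, w', ⟨-, rfl⟩, h⟩ := ha, ha'
    exact (hf _ _ _ _ h).symm

theorem Finer.numFibers_add_sum_numSubfibers_le {ι : Type*} [Fintype ι] (hf : Finer c' c)
    (p : ι → V) (hp : Function.Injective fun i => c (p i) (p i)) :
    numFibers c + ∑ i, numSubfibers c' c (p i) ≤ numFibers c' + Fintype.card ι := by
  classical
  let D := Finset.univ.image fun u => c u u
  let F : K → Finset K' := fun κ => (Finset.univ.filter fun u => c u u = κ).image fun u => c' u u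
  have hF : ∀ κ ∈ D, 0 < (F κ).card := fun κ hκ => by
    obtain ⟨v, -, rfl⟩ := Finset.mem_image.1 hκ
    exact Finset.card_pos.2 ⟨c' v v, Finset.mem_image_of_mem _ (by simp)⟩
  have hsplit : numFibers c' = ∑ κ ∈ D, (F κ).card := hf.numFibers_eq_sum
  have hD : ∑ κ ∈ D, (F κ).card = ∑ κ ∈ D, ((F κ).card - 1) + numFibers c := by
    rw [numFibers, Finset.card_eq_sum_ones, ← Finset.sum_add_distrib]
    exact Finset.sum_congr rfl fun κ hκ => (Nat.sub_add_cancel (hF κ hκ)).symm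
  have hp' : ∑ i, numSubfibers c' c (p i) =
      ∑ i, ((F (c (p i) (p i))).card - 1) + Fintype.card ι := by
    rw [Fintype.card, Finset.card_eq_sum_ones, ← Finset.sum_add_distrib]
    exact Finset.sum_congr rfl fun i _ => (Nat.sub_add_cancel (hF _ (by simp [D]))).symm
  have hle : ∑ i, ((F (c (p i) (p i))).card - 1) ≤ ∑ κ ∈ D, ((F κ).card - 1) := by
    rw [← Finset.sum_image (f := fun κ => (F κ).card - 1) hp.injOn]
    refine Finset.sum_le_sum_of_subset fun κ hκ => ?_
    obtain ⟨i, -, rfl⟩ := Finset.mem_image.1 hκ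
    simp [D]
  omega

theorem Finer.card_image_le_numSubfibers {A : Type*} [DecidableEq A] (hc : Coherent c)
    (hc' : Coherent c') (hf : Finer c' c) {S : Finset V} (hS : Separates c' S) {f : V → A}
    (h : ∀ a b, (∀ s ∈ S, c s a = c s b) → f a = f b) (v : V) :
    ((fiber c v).image f).card ≤ numSubfibers c' c v := by
  classical
  exact card_image_le_card_image fun a _ b _ hab =>
    h a b fun _ hs => hf.eq_of_separates hc hc' hS hs hab

end Fibers

section Linked

variable {V : Type u} {K : Type v} {c : V → V → K} {u u' v v' : V}

/-- The fibers of `u` and `v` are joined by at least two basis relations. -/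
def Linked (c : V → V → K) (u v : V) : Prop :=
  ∃ w, c w w = c v v ∧ c u w ≠ c u v

theorem Linked.congr_right (h : Linked c u v) (hv : c v v = c v' v') : Linked c u v' := by
  obtain ⟨w, hw, hne⟩ := h
  by_cases hvv' : c u v = c u v'
  · exact ⟨w, hw.trans hv, by rwa [← hvv']⟩
  · exact ⟨v, hv, hvv'⟩

theorem Linked.congr_left (hc : Coherent c) (h : Linked c u v) (hu : c u u = c u' u') :
    Linked c u' v := by
  obtain ⟨w, hw, hne⟩ := h
  obtain ⟨σ, hσ⟩ := hc.perm _ _ _ _ hu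
  have hv := hc.right (hσ v).1
  have hlinked : Linked c u' (σ v) :=
    ⟨σ w, by rw [← hv, ← hc.right (hσ w).1, hw], by rwa [← (hσ w).1, ← (hσ v).1]⟩
  exact hlinked.congr_right hv.symm

theorem Linked.symm (hc : Coherent c) (h : Linked c u v) : Linked c v u := by
  obtain ⟨w, hw, hne⟩ := h
  obtain ⟨σ, hσ⟩ := hc.perm _ _ _ _ hw
  have hu := (hσ u).2
  exact ⟨σ u, (hc.left hu).symm, fun hvu => hne (hu.trans (hc.symm _ _ _ _ hvu))⟩

theorem Linked.self (hc : Coherent c) (h : Linked c u v) : Linked c u u := by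
  obtain ⟨w, hw, hne⟩ := h.symm hc
  exact ⟨w, hw, fun hwu => hne (congrArg (c v) (hc.diag _ _ _ hwu).symm)⟩

theorem Coherent.eq_of_not_linked (hc : Coherent c) (h : ¬ Linked c u v) (hu : c u u = c u' u')
    (hv : c v v = c v' v') : c u v = c u' v' := by
  obtain ⟨σ, hσ⟩ := hc.perm _ _ _ _ hu.symm
  rw [(hσ v').1]
  by_contra hne
  exact h ⟨σ v', by rw [← hc.right (hσ v').1, hv], Ne.symm hne⟩

open scoped Classical in
/-- The number of colors of the pairs `(u, w)`, where `w` runs through the fiber of `v`. -/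
noncomputable def numRelations [Fintype V] (c : V → V → K) (u v : V) : ℕ :=
  ((fiber c v).image (c u)).card

theorem Linked.two_le_numRelations [Fintype V] (h : Linked c u v) : 2 ≤ numRelations c u v := by
  classical
  obtain ⟨w, hw, hne⟩ := h
  refine Finset.one_lt_card.2 ⟨c u w, ?_, c u v, ?_, hne⟩
  · exact Finset.mem_image_of_mem _ (mem_fiber.2 hw)
  · exact Finset.mem_image_of_mem _ (mem_fiber.2 rfl)

end Linked

section Stuck

variable {V : Type u} {K : Type v} [Fintype V] {c : V → V → K} {u v w : V}

/-- No set `S` of vertices can be individualized in such a way that at least `4 * |S|` new fibers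
appear. -/
def Stuck (c : V → V → K) : Prop :=
  ∀ S : Finset V, S.Nonempty → ∃ (K' : Type v) (c' : V → V → K'), Coherent c' ∧ Finer c' c ∧
    Separates c' S ∧ numFibers c' < numFibers c + 4 * S.card

theorem Stuck.sum_numRelations_lt (hs : Stuck c) (hc : Coherent c) (u : V) {ι : Type*} [Fintype ι]
    {p : ι → V} (hp : Function.Injective fun i => c (p i) (p i)) :
    ∑ i, numRelations c u (p i) < Fintype.card ι + 4 := by
  classical
  obtain ⟨K', c', hc', hf, hsep, hlt⟩ := hs {u} (Finset.singleton_nonempty u)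
  have hle : ∑ i, numRelations c u (p i) ≤ ∑ i, numSubfibers c' c (p i) :=
    Finset.sum_le_sum fun i _ => hf.card_image_le_numSubfibers hc hc' hsep
      (fun a b hab => hab u (Finset.mem_singleton_self u)) (p i)
  have := hf.numFibers_add_sum_numSubfibers_le p hp
  rw [Finset.card_singleton] at hlt
  omega

/-- Otherwise individualizing the center of the star would split four fibers. -/
theorem Stuck.card_lt_four_of_linked (hs : Stuck c) (hc : Coherent c) {ι : Type*} [Fintype ι]
    {p : ι → V} (hp : Function.Injective fun i => c (p i) (p i)) (hl : ∀ i, Linked c u (p i)) :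
    Fintype.card ι < 4 := by
  have hsum := hs.sum_numRelations_lt hc u hp
  have := Finset.card_nsmul_le_sum Finset.univ (fun i => numRelations c u (p i)) 2
    fun i _ => (hl i).two_le_numRelations
  rw [Finset.card_univ, smul_eq_mul] at this
  omega

/-- All pairs of distinct points of the fiber of `u` have the same color. -/
def FiberRankTwo (c : V → V → K) (u : V) : Prop :=
  ∀ x x' z z', c x x = c u u → c x' x' = c u u → c z z = c u u → c z' z' = c u u →
    x ≠ x' → z ≠ z' → c x x' = c z z'

theorem Coherent.fiberRankTwo_of_numRelations_le (hc : Coherent c)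
    (h : numRelations c u u ≤ 2) : FiberRankTwo c u := by
  classical
  have hu : ∀ x x', c x x = c u u → c x' x' = c u u → x ≠ u → x' ≠ u → c u x = c u x' := by
    intro x x' hx hx' hxu hxu'
    by_contra hne
    refine h.not_gt (Finset.two_lt_card.2 ⟨c u u, ?_, c u x, ?_, c u x', ?_, ?_, ?_, hne⟩)
    · exact Finset.mem_image_of_mem _ (mem_fiber.2 rfl)
    · exact Finset.mem_image_of_mem _ (mem_fiber.2 hx)
    · exact Finset.mem_image_of_mem _ (mem_fiber.2 hx')
    · exact fun h => hxu (hc.diag _ _ _ h.symm).symm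
    · exact fun h => hxu' (hc.diag _ _ _ h.symm).symm
  have key : ∀ x x', c x x = c u u → c x' x' = c u u → x ≠ x' →
      ∃ w, c w w = c u u ∧ w ≠ u ∧ c x x' = c u w := by
    intro x x' hx hx' hne
    obtain ⟨σ, hσ⟩ := hc.perm _ _ _ _ hx
    have hx'u := hσ x'
    refine ⟨σ x', ?_, fun h => hne ?_, hx'u.1⟩
    · rw [← hc.right hx'u.1, hx']
    · exact hc.diag _ _ _ (by rw [hx'u.1, h])
  intro x x' z z' hx hx' hz hz' hxx' hzz'
  obtain ⟨w, hw, hwu, hxw⟩ := key x x' hx hx' hxx'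
  obtain ⟨w', hw', hwu', hzw⟩ := key z z' hz hz' hzz'
  rw [hxw, hzw, hu w w' hw hw' hwu hwu']

theorem Stuck.fiberRankTwo (hs : Stuck c) (hc : Coherent c) (huv : c u u ≠ c v v)
    (huw : c u u ≠ c w w) (hvw : c v v ≠ c w w) (hlv : Linked c u v) (hlw : Linked c u w) :
    FiberRankTwo c u := by
  refine hc.fiberRankTwo_of_numRelations_le ?_
  have hsum := hs.sum_numRelations_lt hc u (p := ![u, v, w])
    (by intro i j; fin_cases i <;> fin_cases j <;> simp [huv, huw, hvw, huv.symm, huw.symm,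
      hvw.symm])
  have := hlv.two_le_numRelations
  have := hlw.two_le_numRelations
  simp only [Fin.sum_univ_three, Matrix.cons_val, Fintype.card_fin] at hsum
  omega

end Stuck

section Fisher

theorem linearIndependent_of_sum_mul {X Y : Type*} [Finite X] [DecidableEq X] [Fintype Y]
    {f : X → Y → ℝ} {a b : ℝ} (hb : 0 ≤ b) (hab : b < a)
    (h : ∀ x x', ∑ y, f x y * f x' y = if x = x' then a else b) : LinearIndependent ℝ f := by
  have := Fintype.ofFinite X
  rw [Fintype.linearIndependent_iff]
  intro g hg
  have hzero : ∀ y, ∑ x, g x * f x y = 0 := fun y => by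
    simpa only [Finset.sum_apply, Pi.smul_apply, smul_eq_mul, Pi.zero_apply] using congrFun hg y
  have hform : (a - b) * ∑ x, g x ^ 2 + b * (∑ x, g x) ^ 2 = 0 := calc
    _ = ∑ x, ∑ x', g x * g x' * if x = x' then a else b := by
      have hentry : ∀ x x', g x * g x' * (if x = x' then a else b) =
          (if x = x' then (a - b) * g x ^ 2 else 0) + b * (g x * g x') := fun x x' => by
        split_ifs with hx
        · rw [hx]
          ring
        · ring
      simp only [hentry, Finset.sum_add_distrib, Finset.sum_ite_eq, Finset.mem_univ, if_true]
      rw [← Finset.mul_sum, sq (∑ x, g x), Finset.sum_mul_sum]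
      simp only [Finset.mul_sum]
    _ = ∑ y, (∑ x, g x * f x y) ^ 2 := by
      symm
      simp only [sq, Finset.sum_mul_sum]
      rw [Finset.sum_comm]
      refine Finset.sum_congr rfl fun x _ => ?_
      rw [Finset.sum_comm]
      refine Finset.sum_congr rfl fun x' _ => ?_
      rw [← h, Finset.mul_sum]
      exact Finset.sum_congr rfl fun y _ => mul_mul_mul_comm _ _ _ _
    _ = 0 := by simp only [hzero, ne_eq, OfNat.ofNat_ne_zero, not_false_eq_true, zero_pow,
        Finset.sum_const_zero]
  have hsq : ∑ x, g x ^ 2 = 0 := by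
    have hnonneg := Finset.sum_nonneg fun x (_ : x ∈ Finset.univ) => sq_nonneg (g x)
    nlinarith [mul_nonneg hb (sq_nonneg (∑ x, g x))]
  intro x
  rw [Finset.sum_eq_zero_iff_of_nonneg fun x _ => sq_nonneg (g x)] at hsq
  exact pow_eq_zero_iff two_ne_zero |>.1 (hsq x (Finset.mem_univ x))

variable {V : Type u} {K : Type v} [Fintype V] {c : V → V → K} {x x' y z z' : V}

open scoped Classical in
/-- The number of common neighbors of `x` and `x'` in the basis relation `a`. -/
noncomputable def numCommon (c : V → V → K) (a : K) (x x' : V) : ℕ :=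
  (Finset.univ.filter fun y => c x y = a ∧ c x' y = a).card

theorem Coherent.numCommon_congr (hc : Coherent c) (a : K) (h : c x x' = c z z') :
    numCommon c a x x' = numCommon c a z z' := by
  obtain ⟨σ, hσ⟩ := hc.perm _ _ _ _ h
  refine Finset.card_equiv σ fun y => ?_
  simp only [Finset.mem_filter, Finset.mem_univ, true_and]
  rw [← (hσ y).1, hc.symm _ _ _ _ (hσ y).2]

theorem Linked.exists_numCommon_lt (hc : Coherent c) (h : Linked c x y) :
    ∃ x', c x' x' = c x x ∧ x' ≠ x ∧
      numCommon c (c x y) x x' < numCommon c (c x y) x x := by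
  classical
  obtain ⟨w, hw, hne⟩ := h
  obtain ⟨σ, hσ⟩ := hc.perm _ _ _ _ hw.symm
  have hcolor : c x y = c (σ x) w := (hσ x).2
  refine ⟨σ x, (hc.left hcolor).symm, fun hx => hne (by rw [hcolor, hx]), ?_⟩
  rw [hc.numCommon_congr _ (hc.left hcolor)]
  refine Finset.card_lt_card ⟨Finset.monotone_filter_right _ fun y _ hy => ⟨hy.2, hy.2⟩,
    fun hsub => ?_⟩
  have hw' : w ∈ Finset.univ.filter fun z => c x z = c x y ∧ c (σ x) z = c x y :=
    hsub (by simp [hcolor])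
  exact hne (Finset.mem_filter.1 hw').2.1

open scoped Classical in
/-- Fisher's inequality: the incidence vectors of the points of the fiber of `x` are linearly
independent, because any two of them have the same inner product. -/
theorem FiberRankTwo.card_fiber_le (h : FiberRankTwo c x) (hc : Coherent c)
    (hl : Linked c x y) :
    (fiber c x).card ≤ ((fiber c y).image fun w (s : fiber c x) => c s w).card := by
  obtain ⟨x₁, hx₁, hne, hlt⟩ := hl.exists_numCommon_lt hc
  let Q := (fiber c y).image fun w (s : fiber c x) => c s w
  let tr : fiber c y → Q := fun w => ⟨_, Finset.mem_image_of_mem _ w.2⟩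
  let f : fiber c x → Q → ℝ := fun s q => if q.1 s = c x y then 1 else 0
  have hsum : ∀ s s' : fiber c x,
      ∑ w, f s (tr w) * f s' (tr w) = numCommon c (c x y) s s' := fun s s' => by
    have hfilter : Finset.univ.filter (fun w => c s w = c x y ∧ c s' w = c x y) =
        (fiber c y).filter (fun w => c s w = c x y ∧ c s' w = c x y) := by
      ext w
      simpa using fun hw _ => hc.right hw
    rw [numCommon, hfilter, Finset.natCast_card_filter, ← Finset.sum_coe_sort (fiber c y)]
    refine Finset.sum_congr rfl fun w _ => ?_
    simp only [f, tr, ite_and, mul_ite, mul_one, mul_zero]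
    split_ifs <;> rfl
  have hentry : ∀ s s' : fiber c x, ∑ w, f s (tr w) * f s' (tr w) =
      if s = s' then (numCommon c (c x y) x x : ℝ) else numCommon c (c x y) x x₁ := by
    intro s s'
    rw [hsum]
    split_ifs with hs
    · rw [hs, hc.numCommon_congr _ (mem_fiber.1 s'.2)]
    · rw [hc.numCommon_congr _ (h _ _ _ _ (mem_fiber.1 s.2) (mem_fiber.1 s'.2) rfl hx₁
        (Subtype.coe_ne_coe.2 hs) hne.symm)]
  have hindep : LinearIndependent ℝ (LinearMap.funLeft ℝ ℝ tr ∘ f) :=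
    linearIndependent_of_sum_mul (Nat.cast_nonneg _) (Nat.cast_lt.2 hlt) hentry
  have hle := hindep.of_comp.fintype_card_le_finrank
  rwa [Module.finrank_fintype_fun_eq_card, Fintype.card_coe, Fintype.card_coe] at hle

end Fisher

section FiberConnected

variable {V : Type u} {K : Type v} {c : V → V → K} {u v : V}

/-- The equivalence relation generated by belonging to the same fiber and being linked. -/
def FiberConnected (c : V → V → K) : V → V → Prop :=
  Relation.EqvGen fun u v => c u u = c v v ∨ Linked c u v

theorem fiberConnected_equivalence (c : V → V → K) : Equivalence (FiberConnected c) :=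
  Relation.EqvGen.is_equivalence _

theorem FiberConnected.of_eq (h : c u u = c v v) : FiberConnected c u v :=
  .rel _ _ (.inl h)

theorem Linked.fiberConnected (h : Linked c u v) : FiberConnected c u v :=
  .rel _ _ (.inr h)

theorem FiberConnected.mem_iff (hc : Coherent c) {C : Finset K}
    (hC : ∀ v w, c v v ∈ C → Linked c v w → c w w ∈ C) (h : FiberConnected c u v) :
    c u u ∈ C ↔ c v v ∈ C := by
  induction h with
  | rel u v h =>
    obtain h | h := h
    · rw [h]
    · exact ⟨fun hu => hC u v hu h, fun hv => hC v u hv (h.symm hc)⟩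
  | refl => rfl
  | symm _ _ _ ih => exact ih.symm
  | trans _ _ _ _ _ ih ih' => exact ih.trans ih'

end FiberConnected

section Components

variable {V : Type u} {K K' : Type v} [Fintype V] {c : V → V → K} {c' : V → V → K'}
variable {u v w x y z : V}

theorem FiberRankTwo.card_fiber_le_numSubfibers (h : FiberRankTwo c u) (hc : Coherent c)
    (hc' : Coherent c') (hf : Finer c' c) (hl : Linked c u v) (hS : Separates c' (fiber c u)) :
    (fiber c u).card ≤ numSubfibers c' c v := by
  classical
  exact (h.card_fiber_le hc hl).trans (hf.card_image_le_numSubfibers hc hc' hS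
    (fun _ _ hab => funext fun (s : fiber c u) => hab s s.2) v)

theorem Finer.separates_fiber_iff (hf : Finer c' c) :
    Separates c' (fiber c v) ↔ (fiber c v).card ≤ numSubfibers c' c v := by
  classical
  rw [numSubfibers, Finset.card_image_le.ge_iff_eq', eq_comm, Finset.card_image_iff]
  constructor
  · exact fun h a _ b hb hab => h b hb a hab
  · intro h s hs u hu
    refine h ?_ hs hu
    rw [Finset.mem_coe, mem_fiber, hf _ _ _ _ hu, mem_fiber.1 hs]

theorem Finer.separates_of_erase [DecidableEq V] (hf : Finer c' c)
    (h : Separates c' ((fiber c v).erase v)) : Separates c' (fiber c v) := by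
  intro s hs u hu
  by_contra hne
  have hu' : u ∈ fiber c v := by rw [mem_fiber, hf _ _ _ _ hu, mem_fiber.1 hs]
  obtain rfl | hsv := eq_or_ne s v
  · exact hne (h u (Finset.mem_erase.2 ⟨hne, hu'⟩) s hu.symm).symm
  · exact hne (h s (Finset.mem_erase.2 ⟨hsv, hs⟩) u hu)

theorem Stuck.not_linked_of_linked_of_linked (hs : Stuck c) (hc : Coherent c) {p : Fin 4 → V}
    (hp : Function.Injective fun i => c (p i) (p i)) (h01 : Linked c (p 1) (p 0))
    (h12 : Linked c (p 1) (p 2)) : ¬ Linked c (p 2) (p 3) := by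
  classical
  intro h23
  have hne : ∀ i j, i ≠ j → c (p i) (p i) ≠ c (p j) (p j) := fun i j => hp.ne
  have hr₁ := hs.fiberRankTwo hc (hne 1 0 (by decide)) (hne 1 2 (by decide))
    (hne 0 2 (by decide)) h01 h12
  have hr₂ := hs.fiberRankTwo hc (hne 2 1 (by decide)) (hne 2 3 (by decide))
    (hne 1 3 (by decide)) (h12.symm hc) h23
  have hle : (fiber c (p 2)).card ≤ (fiber c (p 1)).card :=
    (hr₂.card_fiber_le hc (h12.symm hc)).trans Finset.card_image_le
  have hmem : p 1 ∈ fiber c (p 1) := mem_fiber.2 rfl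
  obtain ⟨q, hq, hqne⟩ := h01.self hc
  obtain ⟨K', c', hc', hf, hsep, hlt⟩ := hs ((fiber c (p 1)).erase (p 1))
    ⟨q, Finset.mem_erase.2 ⟨fun h => hqne (by rw [h]), mem_fiber.2 hq⟩⟩
  have hsep₁ := hf.separates_of_erase hsep
  have h₀ := hr₁.card_fiber_le_numSubfibers hc hc' hf h01 hsep₁
  have h₁ := hf.separates_fiber_iff.1 hsep₁
  have h₂ := hr₁.card_fiber_le_numSubfibers hc hc' hf h12 hsep₁
  have h₂' : numSubfibers c' c (p 2) ≤ (fiber c (p 2)).card := Finset.card_image_le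
  have h₃ := hr₂.card_fiber_le_numSubfibers hc hc' hf h23
    (hf.separates_fiber_iff.2 (hle.trans h₂))
  have hsum := hf.numFibers_add_sum_numSubfibers_le p hp
  have hpos := Finset.card_pos.2 ⟨_, hmem⟩
  rw [Finset.card_erase_of_mem hmem] at hlt
  rw [Fin.sum_univ_four, Fintype.card_fin] at hsum
  omega

theorem Stuck.mem_of_linked_center (hs : Stuck c) (hc : Coherent c) (hxy : Linked c x y)
    (hxz : Linked c x z) (nxy : c x x ≠ c y y) (nxz : c x x ≠ c z z) (nyz : c y y ≠ c z z)
    (hxw : Linked c x w) : c w w = c x x ∨ c w w = c y y ∨ c w w = c z z := by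
  by_contra! hw
  refine (hs.card_lt_four_of_linked hc (p := ![x, y, z, w]) (u := x) ?_ ?_).ne
    (Fintype.card_fin 4)
  · intro i j
    fin_cases i <;> fin_cases j <;> simp [nxy, nxz, nyz, hw, nxy.symm, nxz.symm, nyz.symm,
      hw.1.symm, hw.2.1.symm, hw.2.2.symm]
  · intro i
    fin_cases i
    exacts [hxy.self hc, hxy, hxz, hxw]

theorem Stuck.mem_of_linked_leaf (hs : Stuck c) (hc : Coherent c) (hxy : Linked c x y)
    (hxz : Linked c x z) (nxy : c x x ≠ c y y) (nxz : c x x ≠ c z z) (nyz : c y y ≠ c z z)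
    (hyw : Linked c y w) : c w w = c x x ∨ c w w = c y y ∨ c w w = c z z := by
  by_contra! hw
  refine hs.not_linked_of_linked_of_linked hc (p := ![w, y, x, z]) ?_ hyw (hxy.symm hc) hxz
  intro i j
  fin_cases i <;> fin_cases j <;> simp [nxy, nxz, nyz, hw, nxy.symm, nxz.symm, nyz.symm,
    hw.1.symm, hw.2.1.symm, hw.2.2.symm]

theorem Stuck.mem_of_linked (hs : Stuck c) (hc : Coherent c) (hxy : Linked c x y)
    (hxz : Linked c x z) (nxy : c x x ≠ c y y) (nxz : c x x ≠ c z z) (nyz : c y y ≠ c z z)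
    (hv : c v v = c x x ∨ c v v = c y y ∨ c v v = c z z) (hvw : Linked c v w) :
    c w w = c x x ∨ c w w = c y y ∨ c w w = c z z := by
  obtain hv | hv | hv := hv
  · exact hs.mem_of_linked_center hc hxy hxz nxy nxz nyz (hvw.congr_left hc hv)
  · exact hs.mem_of_linked_leaf hc hxy hxz nxy nxz nyz (hvw.congr_left hc hv)
  · rw [or_comm (a := c w w = c y y)]
    exact hs.mem_of_linked_leaf hc hxz hxy nxz nxy nyz.symm (hvw.congr_left hc hv)

theorem Stuck.exists_colors (hs : Stuck c) (hc : Coherent c) (u : V) :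
    ∃ C : Finset K, C.card ≤ 3 ∧ ∀ v, FiberConnected c u v → c v v ∈ C := by
  classical
  have hE := fiberConnected_equivalence c
  have closed : ∀ (C : Finset K) x, FiberConnected c u x → c x x ∈ C →
      (∀ v w, c v v ∈ C → Linked c v w → c w w ∈ C) → ∀ v, FiberConnected c u v → c v v ∈ C :=
    fun C x hux hx hC v huv =>
      (FiberConnected.mem_iff hc hC (hE.trans (hE.symm hux) huv)).1 hx
  by_cases hstar : ∃ x y z, FiberConnected c u x ∧ Linked c x y ∧ Linked c x z ∧
      c x x ≠ c y y ∧ c x x ≠ c z z ∧ c y y ≠ c z z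
  · obtain ⟨x, y, z, hux, hxy, hxz, nxy, nxz, nyz⟩ := hstar
    refine ⟨{c x x, c y y, c z z}, Finset.card_le_three, closed _ x hux (by simp) ?_⟩
    simpa only [Finset.mem_insert, Finset.mem_singleton] using fun v w =>
      hs.mem_of_linked hc hxy hxz nxy nxz nyz
  push Not at hstar
  by_cases hedge : ∃ y, Linked c u y ∧ c u u ≠ c y y
  · obtain ⟨y, huy, nuy⟩ := hedge
    refine ⟨{c u u, c y y}, Finset.card_le_two.trans (by norm_num),
      closed _ u (hE.refl u) (by simp) fun v w hv hvw => ?_⟩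
    simp only [Finset.mem_insert, Finset.mem_singleton] at hv ⊢
    by_contra! hw
    obtain hv | hv := hv
    · exact hw.2 (hstar u y w (hE.refl u) huy (hvw.congr_left hc hv) nuy hw.1.symm).symm
    · exact hw.1 (hstar y u w huy.fiberConnected (huy.symm hc) (hvw.congr_left hc hv)
        nuy.symm hw.2.symm).symm
  · push Not at hedge
    refine ⟨{c u u}, by simp, closed _ u (hE.refl u) (by simp) fun v w hv hvw => ?_⟩
    rw [Finset.mem_singleton] at hv ⊢
    exact (hedge w (hvw.congr_left hc hv)).symm

end Components

section Restrict

variable {V : Type u} {K K' : Type v} {c : V → V → K} {c' : V → V → K'} {P : V → Prop}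

theorem Coherent.restrict (hc : Coherent c) (hP : ∀ u v, c u u = c v v → P u → P v) :
    Coherent (restrict c P) where
  diag u v w h := Subtype.ext (hc.diag _ _ _ h)
  symm u v u' v' h := hc.symm _ _ _ _ h
  perm u v u' v' h := by
    obtain ⟨σ, hσ⟩ := hc.perm _ _ _ _ h
    refine ⟨σ.subtypeEquiv fun w => ?_, fun w => hσ w⟩
    have hw := hc.right (hσ w).1
    exact ⟨hP _ _ hw, hP _ _ hw.symm⟩

variable [Fintype V]

theorem Finer.numFibers_le (h : Finer c' c) : numFibers c ≤ numFibers c' := by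
  classical
  exact card_image_le_card_image fun _ _ _ _ hab => h _ _ _ _ hab

open scoped Classical in
theorem numFibers_eq_add (hP : ∀ u v, c u u = c v v → P u → P v) :
    numFibers c = numFibers (restrict c P) + numFibers (restrict c fun v => ¬ P v) := by
  have himage : ∀ (Q : V → Prop) [DecidablePred Q],
      (Finset.univ.image fun v => restrict c Q v v) =
        (Finset.univ.filter Q).image fun v => c v v := fun Q _ => by
    ext κ
    simp [Rainbow.restrict]
  rw [numFibers, numFibers, numFibers, himage P, himage fun v => ¬ P v,
    ← Finset.card_union_of_disjoint, ← Finset.image_union, Finset.filter_union_filter_not_eq]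
  refine Finset.disjoint_left.2 fun κ hκ hκ' => ?_
  obtain ⟨v, hv, rfl⟩ := Finset.mem_image.1 hκ
  obtain ⟨w, hw, hvw⟩ := Finset.mem_image.1 hκ'
  exact (Finset.mem_filter.1 hw).2 (hP v w hvw.symm (Finset.mem_filter.1 hv).2)

open scoped Classical in
theorem Stuck.restrict (hs : Stuck c) (hP : ∀ u v, c u u = c v v → P u → P v) :
    Stuck (restrict c P) := by
  intro S hS
  obtain ⟨K', c', hc', hf, hsep, hlt⟩ := hs (S.map (Function.Embedding.subtype P)) hS.map
  have hP' : ∀ u v, c' u u = c' v v → P u → P v := fun u v h => hP u v (hf _ _ _ _ h)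
  refine ⟨K', Rainbow.restrict c' P, hc'.restrict hP', fun u v u' v' h => hf _ _ _ _ h,
    fun s hs u hu => Subtype.ext (hsep s (Finset.mem_map_of_mem _ hs) u hu), ?_⟩
  have hcompl : numFibers (Rainbow.restrict c fun v => ¬ P v) ≤
      numFibers (Rainbow.restrict c' fun v => ¬ P v) :=
    Finer.numFibers_le fun u v u' v' h => hf _ _ _ _ h
  rw [Finset.card_map, numFibers_eq_add hP, numFibers_eq_add hP'] at hlt
  omega

theorem Stuck.identified_of_few_fibers {γ : K → Prop} {k : ℕ} (hk : 3 ≤ k) (hs : Stuck c)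
    (hc : Coherent c) (hγ : ∀ u v, γ (c u v) → γ (c v u))
    (h : ∀ (U : Type u) [Fintype U] [Nonempty U] (e : U → U → K),
      Fintype.card U ≤ Fintype.card V → Stuck e → Coherent e →
      (∀ u v, γ (e u v) → γ (e v u)) → numFibers e ≤ 3 → Identified k e γ) :
    Identified k c γ := by
  classical
  have hE := fiberConnected_equivalence c
  have hcongr : ∀ u v u' v', c u u = c u' u' → c v v = c v' v' → FiberConnected c u v →
      FiberConnected c u' v' := fun u v u' v' hu hv huv =>
    hE.trans (hE.trans (.of_eq hu.symm) huv) (.of_eq hv)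
  obtain ⟨E, hEiff⟩ : ∃ E : K → Prop, ∀ u v, E (c u v) ↔ FiberConnected c u v :=
    ⟨fun a => ∃ u v, c u v = a ∧ FiberConnected c u v, fun u v =>
      ⟨fun ⟨u', v', huv, h⟩ => hcongr _ _ _ _ (hc.left huv) (hc.right huv) h,
        fun h => ⟨u, v, rfl, h⟩⟩⟩
  refine Identified.of_components hk E (by simpa only [hEiff] using hE) ?_ fun p => ?_
  · intro u v u' v' huv _ hu hv
    rw [hEiff] at huv
    rw [hc.eq_of_not_linked (fun h => huv h.fiberConnected) hu hv]
  · have hP : ∀ u v, c u u = c v v → E (c p u) → E (c p v) := fun u v huv => by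
      simpa only [hEiff] using hcongr _ _ _ _ rfl huv
    have : Nonempty {v // E (c p v)} := ⟨p, (hEiff p p).2 (hE.refl p)⟩
    obtain ⟨C, hC, hpC⟩ := hs.exists_colors hc p
    refine h _ _ (Fintype.card_subtype_le _) (hs.restrict hP) (hc.restrict hP)
      (fun u v => hγ u v) ((Finset.card_le_card fun κ hκ => ?_).trans hC)
    obtain ⟨v, -, rfl⟩ := Finset.mem_image.1 hκ
    exact hpC v ((hEiff p v).1 v.2)

end Restrict

section HittingSet

theorem two_mul_sub_pow_le {n θ : ℕ} (hθ : 0 < θ) (hθn : θ ≤ n) :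
    2 * (n - θ) ^ (n / θ + 1) ≤ n ^ (n / θ + 1) := calc
  2 * (n - θ) ^ (n / θ + 1)
      = (n - θ) ^ (n / θ + 1) + (n - θ) ^ (n / θ) * (n - θ) := by rw [two_mul, ← pow_succ]
  _ ≤ (n - θ) ^ (n / θ + 1) + (n - θ) ^ (n / θ) * ((n / θ + 1) * θ) := by
    gcongr
    exact (Nat.sub_le _ _).trans (by rw [mul_comm]; exact (Nat.lt_mul_div_succ n hθ).le)
  _ ≤ (n - θ + θ) ^ (n / θ + 1) := by
    have h := pow_add_mul_le_add_pow (Nat.zero_le (n - θ)) (Nat.zero_le (2 * (n - θ) + θ))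
      (n / θ + 1)
    rw [Nat.add_sub_cancel, Nat.cast_id] at h
    rwa [mul_left_comm, ← mul_assoc]
  _ = n ^ (n / θ + 1) := by rw [Nat.sub_add_cancel hθn]

/-- A random set hits every member: the functions `Fin (T * (n / θ + 1)) → V` whose range misses a
given member are too few to exhaust all of them. -/
theorem exists_hitting_set {V : Type*} [Fintype V] {𝒟 : Finset (Finset V)}
    {θ T : ℕ} (hθ : 0 < θ) (hD : ∀ D ∈ 𝒟, θ ≤ D.card) (h𝒟 : 𝒟.card < 2 ^ T) :
    ∃ S : Finset V, S.card ≤ T * (Fintype.card V / θ + 1) ∧ ∀ D ∈ 𝒟, ∃ s ∈ S, s ∈ D := by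
  classical
  obtain rfl | ⟨D₀, hD₀⟩ := 𝒟.eq_empty_or_nonempty
  · exact ⟨∅, by simp⟩
  set n := Fintype.card V
  set L := T * (n / θ + 1) with hL
  have hθn : θ ≤ n := (hD D₀ hD₀).trans (Finset.card_le_univ _)
  by_contra! hno
  have hcover : (Finset.univ : Finset (Fin L → V)) ⊆
      𝒟.biUnion fun D => Fintype.piFinset fun _ => Dᶜ := fun f _ => by
    obtain ⟨D, hD, hf⟩ := hno (Finset.univ.image f) (Finset.card_image_le.trans (by simp))
    refine Finset.mem_biUnion.2 ⟨D, hD, Fintype.mem_piFinset.2 fun i => ?_⟩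
    exact Finset.mem_compl.2 (hf _ (Finset.mem_image_of_mem _ (Finset.mem_univ i)))
  have hle : n ^ L ≤ 𝒟.card * (n - θ) ^ L := calc
    n ^ L = (Finset.univ : Finset (Fin L → V)).card := by simp [n]
    _ ≤ 𝒟.card * (n - θ) ^ L := by
      refine (Finset.card_le_card hcover).trans
        (Finset.card_biUnion_le_card_mul _ _ _ fun D h => ?_)
      rw [Fintype.card_piFinset_const, Finset.card_compl]
      exact Nat.pow_le_pow_left (Nat.sub_le_sub_left (hD D h) _) _
  have hpow : 2 ^ T * (n - θ) ^ L ≤ n ^ L := by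
    have h := Nat.pow_le_pow_left (two_mul_sub_pow_le hθ hθn) T
    rwa [mul_pow, ← pow_mul, ← pow_mul, mul_comm _ T, ← hL] at h
  have hpos : 0 < n ^ L := pow_pos (hθ.trans_le hθn) _
  have hpos' : 0 < (n - θ) ^ L := Nat.pos_of_mul_pos_left (hpos.trans_le hle)
  exact (Nat.mul_lt_mul_of_pos_right h𝒟 hpos').not_ge (hpow.trans hle)

end HittingSet

section Scattered

variable {V : Type u} {G : SimpleGraph V} {u v : V}

theorem exists_edist_le_of_edist_le_add {i j : ℕ} (h : G.edist u v ≤ i + j) :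
    ∃ w, G.edist u w ≤ i ∧ G.edist w v ≤ j := by
  obtain ⟨p, hp⟩ := SimpleGraph.exists_walk_of_edist_ne_top
    (ne_top_of_le_ne_top (ENat.natCast_ne_top (i + j)) h)
  rw [← hp, ← Nat.cast_add, Nat.cast_le] at h
  refine ⟨p.getVert i, (G.edist_le (p.take i)).trans ?_, (G.edist_le (p.drop i)).trans ?_⟩
  · simp
  · rw [SimpleGraph.Walk.drop_length, Nat.cast_le]
    omega

theorem exists_edist_eq (h : G.Reachable u v) {j : ℕ} (hj : j ≤ G.edist u v) :
    ∃ w, G.edist u w = j := by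
  rw [← h.coe_dist_eq_edist, Nat.cast_le] at hj
  obtain ⟨i, hi⟩ := Nat.exists_eq_add_of_le hj
  have hdist : G.edist u v = j + i := by rw [← h.coe_dist_eq_edist, hi, Nat.cast_add]
  obtain ⟨w, hw, hwv⟩ := exists_edist_le_of_edist_le_add hdist.le
  refine ⟨w, hw.antisymm ?_⟩
  rw [← ENat.add_le_add_iff_right (ENat.natCast_ne_top i), ← hdist]
  exact G.edist_triangle.trans (add_le_add_right hwv _)

open scoped Classical in
theorem card_edist_le [Fintype V] {η : ℕ}
    (hη : ∀ x, (Finset.univ.filter (G.Adj x)).card ≤ η) (j : ℕ) (u : V) :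
    (Finset.univ.filter fun v => G.edist u v ≤ j).card ≤ (η + 1) ^ j := by
  induction j with
  | zero => simp [Finset.filter_eq]
  | succ j ih =>
    have hsub : (Finset.univ.filter fun v => G.edist u v ≤ (j + 1 : ℕ)) ⊆
        (Finset.univ.filter fun v => G.edist u v ≤ j).biUnion fun z =>
          insert z (Finset.univ.filter (G.Adj z)) := fun v hv => by
      rw [Finset.mem_filter_univ, Nat.cast_succ, ← Nat.cast_one] at hv
      obtain ⟨z, hz, hzv⟩ := exists_edist_le_of_edist_le_add hv
      rw [Nat.cast_one, SimpleGraph.edist_le_one_iff_adj_or_eq] at hzv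
      simp only [Finset.mem_biUnion, Finset.mem_insert, Finset.mem_filter_univ]
      exact ⟨z, hz, hzv.symm.imp_left Eq.symm⟩
    calc _ ≤ _ := Finset.card_le_card hsub
      _ ≤ _ * (η + 1) := Finset.card_biUnion_le_card_mul _ _ _ fun z _ =>
        (Finset.card_insert_le _ _).trans (Nat.succ_le_succ (hη z))
      _ ≤ (η + 1) ^ j * (η + 1) := Nat.mul_le_mul_right _ ih
      _ = (η + 1) ^ (j + 1) := (pow_succ _ _).symm

theorem exists_isSeparated_isCover [Finite V] (U : SetRel V V) [U.IsRefl] [U.IsSymm]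
    (s : Set V) : ∃ N ⊆ s, U.IsSeparated N ∧ U.IsCover s N := by
  obtain ⟨N, hN⟩ := (Set.toFinite {N | N ⊆ s ∧ U.IsSeparated N}).exists_maximal
    ⟨∅, Set.empty_subset s, .empty⟩
  exact ⟨N, hN.1.1, hN.1.2, .of_maximal_isSeparated hN⟩

end Scattered

section Eccentric

variable {V : Type u} [Fintype V] {G : SimpleGraph V}

open scoped Classical in
/-- A component either has radius less than `m` or is covered by the balls around `N`. -/
theorem card_reachable_le {η m t : ℕ} (hη : ∀ x, (Finset.univ.filter (G.Adj x)).card ≤ η)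
    (ht : 0 < t) {N : Finset V} (hN : N.card ≤ t)
    (hcover : ∀ u, (∃ v, G.edist u v = m) → ∃ x ∈ N, G.edist x u ≤ (2 * m : ℕ)) (p : V) :
    (Finset.univ.filter (G.Reachable p)).card ≤ t * (η + 1) ^ (2 * m) := by
  by_cases h : ∃ u, G.Reachable p u ∧ ∀ v, G.edist u v ≠ m
  · obtain ⟨u, hpu, hu⟩ := h
    calc (Finset.univ.filter (G.Reachable p)).card
        ≤ (Finset.univ.filter fun v => G.edist u v ≤ m).card := by
          refine Finset.card_le_card (Finset.monotone_filter_right _ fun v _ hpv => ?_)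
          by_contra hmv
          obtain ⟨w, hw⟩ := exists_edist_eq (hpu.symm.trans hpv) (not_le.1 hmv).le
          exact hu w hw
      _ ≤ (η + 1) ^ m := card_edist_le hη m u
      _ ≤ (η + 1) ^ (2 * m) := Nat.pow_le_pow_right (Nat.succ_pos _) (by omega)
      _ ≤ t * (η + 1) ^ (2 * m) := Nat.le_mul_of_pos_left _ ht
  · push Not at h
    calc (Finset.univ.filter (G.Reachable p)).card
        ≤ (N.biUnion fun x => Finset.univ.filter fun v => G.edist x v ≤ (2 * m : ℕ)).card := by
          refine Finset.card_le_card fun v hv => ?_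
          obtain ⟨x, hx, hxv⟩ := hcover v (h v (Finset.mem_filter.1 hv).2)
          exact Finset.mem_biUnion.2 ⟨x, hx, Finset.mem_filter.2 ⟨Finset.mem_univ _, hxv⟩⟩
      _ ≤ N.card * (η + 1) ^ (2 * m) :=
          Finset.card_biUnion_le_card_mul _ _ _ fun x _ => card_edist_le hη _ x
      _ ≤ t * (η + 1) ^ (2 * m) := Nat.mul_le_mul_right _ hN

end Eccentric

section Coherent

variable {V : Type u} {K : Type v} {c : V → V → K} {G : SimpleGraph V} {u v u' v' : V}

theorem Coherent.exists_walk_length_eq (hc : Coherent c)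
    (hG : ∀ u v u' v', c u v = c u' v' → G.Adj u v → G.Adj u' v') (p : G.Walk u v)
    (h : c u v = c u' v') : ∃ q : G.Walk u' v', q.length = p.length := by
  induction p generalizing u' v' with
  | nil =>
    obtain rfl := hc.diag _ _ _ h.symm
    exact ⟨.nil, rfl⟩
  | @cons _ w _ huw p ih =>
    obtain ⟨σ, hσ⟩ := hc.perm _ _ _ _ h
    obtain ⟨q, hq⟩ := ih (hσ w).2
    exact ⟨.cons (hG _ _ _ _ (hσ w).1 huw) q, by simp [hq]⟩

theorem Coherent.edist_congr (hc : Coherent c)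
    (hG : ∀ u v u' v', c u v = c u' v' → G.Adj u v → G.Adj u' v') (h : c u v = c u' v') :
    G.edist u v = G.edist u' v' := by
  refine le_antisymm (le_iInf fun p => ?_) (le_iInf fun p => ?_)
  · obtain ⟨q, hq⟩ := hc.exists_walk_length_eq hG p h.symm
    exact hq ▸ G.edist_le q
  · obtain ⟨q, hq⟩ := hc.exists_walk_length_eq hG p h
    exact hq ▸ G.edist_le q

theorem Coherent.card_scattered_le [Fintype V] (hc : Coherent c)
    (hG : ∀ u v u' v', c u v = c u' v' → G.Adj u v → G.Adj u' v') {S N : Finset V} {m : ℕ}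
    (hS : Separates c S) (hNS : N ⊆ S)
    (hsep : ∀ u ∈ N, ∀ v ∈ N, G.edist u v ≤ (2 * m : ℕ) → u = v)
    (hdeep : ∀ u ∈ N, ∃ v, G.edist u v = m) : N.card * (m + 1) ≤ numFibers c := by
  classical
  have hex : ∀ u ∈ N, ∀ j ≤ m, ∃ w, G.edist u w = j := fun u hu j hj => by
    obtain ⟨v, hv⟩ := hdeep u hu
    refine exists_edist_eq (SimpleGraph.reachable_of_edist_ne_top ?_) (v := v) ?_
    · rw [hv]
      exact ENat.natCast_ne_top m
    · rwa [hv, Nat.cast_le]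
  choose! w hw using hex
  rw [numFibers, ← Finset.card_range (m + 1), ← Finset.card_product]
  refine Finset.card_le_card_of_injOn (fun p => c (w p.1 p.2) (w p.1 p.2))
    (fun p _ => Finset.mem_coe.2 (Finset.mem_image_of_mem _ (Finset.mem_univ _))) ?_
  rintro ⟨u, i⟩ hu ⟨v, j⟩ hv huv
  simp only [Finset.coe_product, Set.mem_prod, Finset.mem_coe, Finset.mem_range,
    Nat.lt_succ_iff] at hu hv huv
  have hdist : G.edist u (w v j) = i := by
    rw [← hw u hu.1 i hu.2, G.edist_comm, G.edist_comm (u := u)]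
    exact hc.edist_congr hG (hc.eq_of_separates hS (hNS hu.1) huv.symm)
  have heq : u = v := hsep u hu.1 v hv.1 (by
    refine (G.edist_triangle (v := w v j)).trans ?_
    rw [hdist, G.edist_comm, hw v hv.1 j hv.2, ← Nat.cast_add, Nat.cast_le]
    omega)
  subst heq
  rw [hw u hv.1 j hv.2, Nat.cast_inj] at hdist
  rw [hdist]

end Coherent

section Majority

variable {V : Type u} {K : Type v} [Fintype V] {adj : V → V → Prop} {c : V → V → K}
variable {u w u' w' : V}

theorem fiber_congr (h : c u u = c w w) : fiber c u = fiber c w := by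
  ext a
  simp [h]

theorem card_fiber_pos : 0 < (fiber c u).card :=
  Finset.card_pos.2 ⟨u, mem_fiber.2 rfl⟩

open scoped Classical in
/-- At least half of the pairs between the fibers of `u` and `w` are adjacent. -/
def Majority (adj : V → V → Prop) (c : V → V → K) (u w : V) : Prop :=
  (fiber c u).card * (fiber c w).card ≤ 2 * (Rel.interedges adj (fiber c u) (fiber c w)).card

/-- Adjacency after complementing the edges between fibers that are joined densely. -/
def Flipped (adj : V → V → Prop) (c : V → V → K) (u w : V) : Prop :=
  ¬ (adj u w ↔ Majority adj c u w)

theorem majority_congr (hu : c u u = c u' u') (hw : c w w = c w' w') :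
    Majority adj c u w ↔ Majority adj c u' w' := by
  rw [Majority, Majority, fiber_congr hu, fiber_congr hw]

theorem majority_comm [Std.Symm adj] : Majority adj c u w ↔ Majority adj c w u := by
  classical
  rw [Majority, Majority, Rel.card_interedges_comm, mul_comm]

theorem Flipped.symm [Std.Symm adj] (h : Flipped adj c u w) : Flipped adj c w u := by
  rwa [Flipped, majority_comm, comm_of adj]

theorem flipped_iff_flipped_iff (hu : c u u = c u' u') :
    (Flipped adj c u w ↔ Flipped adj c u' w) ↔ (adj u w ↔ adj u' w) := by
  rw [Flipped, Flipped, majority_congr hu rfl]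
  tauto

theorem Coherent.flipped_congr (hc : Coherent c)
    (hadj : ∀ u v u' v', c u v = c u' v' → (adj u v ↔ adj u' v'))
    (h : c u w = c u' w') : Flipped adj c u w ↔ Flipped adj c u' w' := by
  rw [Flipped, Flipped, hadj _ _ _ _ h, majority_congr (hc.left h) (hc.right h)]

open scoped Classical in
theorem Coherent.card_adj_congr (hc : Coherent c)
    (hadj : ∀ u v u' v', c u v = c u' v' → (adj u v ↔ adj u' v')) (u : V)
    (h : c w w = c w' w') :
    ((fiber c u).filter fun a => adj a w).card = ((fiber c u).filter fun a => adj a w').card := by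
  obtain ⟨σ, hσ⟩ := hc.perm _ _ _ _ h
  refine Finset.card_equiv σ fun a => ?_
  simp only [Finset.mem_filter, mem_fiber]
  rw [hc.left (hσ a).2, hadj _ _ _ _ (hσ a).2]

open scoped Classical in
theorem Coherent.majority_iff (hc : Coherent c)
    (hadj : ∀ u v u' v', c u v = c u' v' → (adj u v ↔ adj u' v')) :
    Majority adj c u w ↔
      (fiber c u).card ≤ 2 * ((fiber c u).filter fun a => adj a w).card := by
  have hcount : (Rel.interedges adj (fiber c u) (fiber c w)).card =
      ((fiber c u).filter fun a => adj a w).card * (fiber c w).card := by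
    rw [Rel.interedges, Finset.card_filter, Finset.sum_product_right, mul_comm, ← smul_eq_mul]
    refine Finset.sum_eq_card_nsmul fun b hb => ?_
    rw [← Finset.card_filter, hc.card_adj_congr hadj u (mem_fiber.1 hb)]
  rw [Majority, hcount, ← mul_assoc, mul_le_mul_iff_left₀ card_fiber_pos]

open scoped Classical in
theorem Coherent.two_mul_card_flipped_le (hc : Coherent c)
    (hadj : ∀ u v u' v', c u v = c u' v' → (adj u v ↔ adj u' v')) (u w : V) :
    2 * ((fiber c u).filter fun a => Flipped adj c a w).card ≤ (fiber c u).card := by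
  have hflip : ∀ a ∈ fiber c u, (Flipped adj c a w ↔ ¬ (adj a w ↔ Majority adj c u w)) :=
    fun a ha => by rw [Flipped, majority_congr (mem_fiber.1 ha) rfl]
  rw [Finset.filter_congr hflip]
  have hsplit := Finset.card_filter_add_card_filter_not (s := fiber c u) fun a => adj a w
  by_cases h : Majority adj c u w
  · have := (hc.majority_iff hadj).1 h
    simp only [h, iff_true]
    omega
  · have := mt (hc.majority_iff hadj).2 h
    simp only [h, iff_false, not_not]
    omega

open scoped Classical in
theorem card_mul_card_filter_le {α : Type*} {s : Finset α} {p : α → Prop}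
    (h : 2 * (s.filter p).card ≤ s.card) :
    s.card * (s.filter p).card ≤ ((s ×ˢ s).filter fun a => ¬ (p a.1 ↔ p a.2)).card := by
  have hsplit := Finset.card_filter_add_card_filter_not (s := s) p
  have hdisj : Disjoint (s.filter p ×ˢ s.filter (¬ p ·)) (s.filter (¬ p ·) ×ˢ s.filter p) :=
    Finset.disjoint_product.2 (.inl (Finset.disjoint_filter_filter_not s s p))
  calc s.card * (s.filter p).card
      ≤ (2 * (s.filter (¬ p ·)).card) * (s.filter p).card := Nat.mul_le_mul_right _ (by omega)
    _ = (s.filter p ×ˢ s.filter (¬ p ·) ∪ s.filter (¬ p ·) ×ˢ s.filter p).card := by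
        rw [Finset.card_union_of_disjoint hdisj, Finset.card_product, Finset.card_product]
        ring
    _ ≤ _ := Finset.card_le_card fun a ha => by
        simp only [Finset.mem_union, Finset.mem_product, Finset.mem_filter] at ha ⊢
        tauto

open scoped Classical in
theorem Coherent.card_flipped_congr (hc : Coherent c)
    (hadj : ∀ u v u' v', c u v = c u' v' → (adj u v ↔ adj u' v')) (h : c u u = c u' u') :
    (Finset.univ.filter (Flipped adj c u)).card = (Finset.univ.filter (Flipped adj c u')).card := by
  obtain ⟨σ, hσ⟩ := hc.perm _ _ _ _ h
  refine Finset.card_equiv σ fun w => ?_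
  rw [Finset.mem_filter_univ, Finset.mem_filter_univ, hc.flipped_congr hadj (hσ w).1]

open scoped Classical in
theorem Coherent.card_flipped_le (hc : Coherent c)
    (hadj : ∀ u v u' v', c u v = c u' v' → (adj u v ↔ adj u' v')) {η : ℕ}
    (hη : ∀ u v, c u u = c v v →
      (Finset.univ.filter fun w => ¬ (adj u w ↔ adj v w)).card ≤ η) (u : V) :
    (Finset.univ.filter (Flipped adj c u)).card ≤ η := by
  set B := fiber c u
  have hB : ∀ p ∈ B ×ˢ B, c p.1 p.1 = c p.2 p.2 := fun p hp =>
    (mem_fiber.1 (Finset.mem_product.1 hp).1).trans (mem_fiber.1 (Finset.mem_product.1 hp).2).symm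
  have hcount : B.card * (Finset.univ.filter (Flipped adj c u)).card =
      ∑ w, (B.filter fun a => Flipped adj c a w).card := by
    rw [← smul_eq_mul, ← Finset.sum_const]
    refine (Finset.sum_congr rfl fun a ha => ?_).trans
      (Finset.sum_card_bipartiteAbove_eq_sum_card_bipartiteBelow (Flipped adj c))
    exact hc.card_flipped_congr hadj (mem_fiber.1 ha).symm
  have hpairs : ∀ w, B.card * (B.filter fun a => Flipped adj c a w).card ≤
      ((B ×ˢ B).filter fun p => ¬ (adj p.1 w ↔ adj p.2 w)).card := fun w => by
    rw [← Finset.filter_congr fun p hp => not_congr (flipped_iff_flipped_iff (hB p hp))]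
    exact card_mul_card_filter_le (hc.two_mul_card_flipped_le hadj u w)
  suffices B.card * B.card * (Finset.univ.filter (Flipped adj c u)).card ≤ B.card * B.card * η from
    Nat.le_of_mul_le_mul_left this (Nat.mul_pos card_fiber_pos card_fiber_pos)
  calc B.card * B.card * (Finset.univ.filter (Flipped adj c u)).card
      = ∑ w, B.card * (B.filter fun a => Flipped adj c a w).card := by
        rw [mul_assoc, hcount, Finset.mul_sum]
    _ ≤ ∑ w, ((B ×ˢ B).filter fun p => ¬ (adj p.1 w ↔ adj p.2 w)).card :=
        Finset.sum_le_sum fun w _ => hpairs w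
    _ = ∑ p ∈ B ×ˢ B, (Finset.univ.filter fun w => ¬ (adj p.1 w ↔ adj p.2 w)).card :=
        (Finset.sum_card_bipartiteAbove_eq_sum_card_bipartiteBelow
          fun (p : V × V) w => ¬ (adj p.1 w ↔ adj p.2 w)).symm
    _ ≤ B.card * B.card * η := by
        rw [← Finset.card_product, ← smul_eq_mul]
        exact Finset.sum_le_card_nsmul _ _ _ fun p hp => hη _ _ (hB p hp)

/-- The graph of `Flipped` without loops. -/
def flippedGraph (adj : V → V → Prop) (c : V → V → K) : SimpleGraph V :=
  .fromRel (Flipped adj c)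

theorem flippedGraph_adj [Std.Symm adj] :
    (flippedGraph adj c).Adj u w ↔ u ≠ w ∧ Flipped adj c u w := by
  rw [flippedGraph, SimpleGraph.fromRel_adj, or_iff_left_of_imp Flipped.symm]

theorem Coherent.flippedGraph_adj_congr [Std.Symm adj] (hc : Coherent c)
    (hadj : ∀ u v u' v', c u v = c u' v' → (adj u v ↔ adj u' v')) (h : c u w = c u' w')
    (huw : (flippedGraph adj c).Adj u w) : (flippedGraph adj c).Adj u' w' := by
  rw [flippedGraph_adj] at huw ⊢
  refine ⟨?_, (hc.flipped_congr hadj h).1 huw.2⟩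
  rintro rfl
  exact huw.1 (hc.diag _ _ _ h)

theorem adj_iff_of_not_reachable (hu : c u u = c u' u') (hw : c w w = c w' w')
    (h : ¬ (flippedGraph adj c).Reachable u w) (h' : ¬ (flippedGraph adj c).Reachable u' w') :
    adj u w ↔ adj u' w' := by
  have hmaj : ∀ {a b}, ¬ (flippedGraph adj c).Reachable a b →
      (adj a b ↔ Majority adj c a b) := fun {a b} hab => by
    by_contra hflip
    refine hab (SimpleGraph.Adj.reachable ((SimpleGraph.fromRel_adj _ _ _).2 ⟨?_, .inl hflip⟩))
    rintro rfl
    exact hab .rfl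
  rw [hmaj h, hmaj h', majority_congr hu hw]

end Majority

section Discrepancy

variable {V : Type u} {K : Type v} [Fintype V] {c : V → V → K} {γ : K → Prop}

open scoped Classical in
/-- The vertices on which the `γ`-neighborhoods of `u` and `v` differ. -/
noncomputable def discrepancy (γ : K → Prop) (c : V → V → K) (u v : V) : Finset V :=
  {w | ¬ (γ (c u w) ↔ γ (c v w))}

theorem Coherent.card_discrepancy_congr (hc : Coherent c) (γ : K → Prop) {u v u' v' : V}
    (h : c u v = c u' v') :
    (discrepancy γ c u v).card = (discrepancy γ c u' v').card := by
  obtain ⟨σ, hσ⟩ := hc.perm _ _ _ _ h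
  refine Finset.card_equiv σ fun w => ?_
  simp only [discrepancy, Finset.mem_filter_univ]
  rw [(hσ w).1, hc.symm _ _ _ _ (hσ w).2]

theorem Stuck.numRelations_le_four (hs : Stuck c) (hc : Coherent c) (u v : V) :
    numRelations c u v ≤ 4 := by
  have hsum := hs.sum_numRelations_lt hc u (ι := Unit) (p := fun _ => v) fun _ _ _ => rfl
  rw [Fintype.sum_unique, Fintype.card_unit] at hsum
  omega

theorem Stuck.exists_discrepancies (hs : Stuck c) (hc : Coherent c) (γ : K → Prop) :
    ∃ D : Finset ℕ, D.card ≤ 4 * numFibers c ∧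
      ∀ u v, c u u = c v v → (discrepancy γ c u v).card ∈ D := by
  classical
  let F : K → Finset ℕ := fun κ => (Finset.univ.filter fun p : V × V =>
    c p.1 p.1 = κ ∧ c p.2 p.2 = κ).image fun p => (discrepancy γ c p.1 p.2).card
  have hF : ∀ a, (F (c a a)).card ≤ 4 := fun a => by
    refine le_trans (Finset.card_le_card (t := (fiber c a).image fun w =>
      (discrepancy γ c a w).card) fun m hm => ?_) ((card_image_le_card_image fun u _ v _ huv =>
        hc.card_discrepancy_congr γ huv).trans (hs.numRelations_le_four hc a a))
    simp only [F, Finset.mem_image, Finset.mem_filter_univ] at hm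
    obtain ⟨⟨u, v⟩, ⟨hu, hv⟩, rfl⟩ := hm
    obtain ⟨σ, hσ⟩ := hc.perm _ _ _ _ hu
    refine Finset.mem_image.2 ⟨σ v, ?_, (hc.card_discrepancy_congr γ (hσ v).1).symm⟩
    rw [mem_fiber, ← hc.right (hσ v).1, hv]
  refine ⟨(Finset.univ.image fun u => c u u).biUnion F, ?_, fun u v huv => ?_⟩
  · rw [mul_comm]
    refine Finset.card_biUnion_le_card_mul _ _ _ fun κ hκ => ?_
    obtain ⟨a, -, rfl⟩ := Finset.mem_image.1 hκ
    exact hF a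
  · exact Finset.mem_biUnion.2 ⟨c u u, Finset.mem_image_of_mem _ (Finset.mem_univ _),
      Finset.mem_image.2 ⟨(u, v), by simp [huv], rfl⟩⟩

theorem exists_gap {θ : ℕ → ℕ} (hθ : Monotone θ) (D : Finset ℕ) :
    ∃ i ≤ D.card, ∀ d ∈ D, d < θ (i + 1) → d < θ i := by
  by_contra! h
  choose! g hgD hlt hle using h
  have hmem : ∀ i ∈ Finset.range (D.card + 1), g i ∈ Set.Ico (θ i) (θ (i + 1)) := fun i hi =>
    have hi := Finset.mem_range_succ_iff.1 hi
    ⟨hle i hi, hlt i hi⟩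
  obtain ⟨i, hi, j, hj, hij, hg⟩ := Finset.exists_ne_map_eq_of_card_lt_of_maps_to (t := D)
    (by simp) fun i hi => hgD i (Finset.mem_range_succ_iff.1 hi)
  exact Set.disjoint_left.1 (hθ.pairwise_disjoint_on_Ico_succ hij) (hmem i hi) (hg ▸ hmem j hj)

end Discrepancy

section Gap

variable {V : Type u} {K K' : Type v} [Fintype V] {c : V → V → K} {y : V → V → K'}
variable {γ : K → Prop} {S : Finset V}

open scoped Classical in
theorem Finer.card_flippedGraph_adj_le [Std.Symm fun u v => γ (c u v)] (hf : Finer y c)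
    (hy : Coherent y) (hsep : Separates y S) {η θ : ℕ}
    (hS : ∀ u v, θ ≤ (discrepancy γ c u v).card → ∃ s ∈ S, s ∈ discrepancy γ c u v)
    (hgap : ∀ u v, c u u = c v v → (discrepancy γ c u v).card < θ →
      (discrepancy γ c u v).card ≤ η) (u : V) :
    (Finset.univ.filter ((flippedGraph (fun u v => γ (c u v)) y).Adj u)).card ≤ η := by
  refine (Finset.card_le_card (Finset.monotone_filter_right _ fun w _ h =>
    (flippedGraph_adj.1 h).2)).trans (hy.card_flipped_le (fun u v u' v' h => by
      rw [hf _ _ _ _ h]) (fun u v huv => ?_) u)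
  refine hgap u v (hf _ _ _ _ huv) (lt_of_not_ge fun hle => ?_)
  obtain ⟨s, hs, hmem⟩ := hS u v hle
  rw [discrepancy, Finset.mem_filter_univ, hf _ _ _ _ (hy.eq_of_separates hsep hs huv)] at hmem
  exact hmem .rfl

theorem Stuck.exists_cover {π : K' → K} (hs : Stuck c) (h3 : numFibers c ≤ 3)
    (hI : IsIndividualization c y π S) {G : SimpleGraph V}
    (hG : ∀ u v u' v', y u v = y u' v' → G.Adj u v → G.Adj u' v') :
    ∃ N : Finset V, N.card ≤ 3 + 4 * S.card ∧
      ∀ u, (∃ v, G.edist u v = 4) → ∃ x ∈ N, G.edist x u ≤ 8 := by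
  classical
  let U : SetRel V V := {p | G.edist p.1 p.2 ≤ 8}
  have : U.IsRefl := ⟨fun u => by simp [U]⟩
  have : U.IsSymm := ⟨fun u v h => by simpa [U, G.edist_comm] using h⟩
  obtain ⟨N, hN, hsep, hcover⟩ := exists_isSeparated_isCover U {u | ∃ v, G.edist u v = 4}
  lift N to Finset V using Set.toFinite _
  refine ⟨N, ?_, fun u hu => ?_⟩
  · obtain hemp | hne := (S ∪ N).eq_empty_or_nonempty
    · simp [(Finset.union_eq_empty.1 hemp).2]
    obtain ⟨K'', d, hd, hf, hsep', hlt⟩ := hs _ hne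
    have hfy := hI.coarsest K'' d hd hf fun s hs => hsep' s (Finset.mem_union_left _ hs)
    have hcard := hd.card_scattered_le (m := 4)
      (fun u v u' v' h => hG _ _ _ _ (hfy _ _ _ _ h)) hsep' Finset.subset_union_right
      (fun u hu v hv huv => by_contra fun hne => hsep hu hv hne huv) fun u hu => hN hu
    have := Finset.card_union_le S N
    omega
  · obtain ⟨x, hx, hux⟩ := hcover hu
    exact ⟨x, hx, by rwa [G.edist_comm]⟩

theorem Stuck.identified_of_gap [Nonempty V] (hs : Stuck c) (hc : Coherent c)
    (hγ : ∀ u v, γ (c u v) → γ (c v u)) (h3 : numFibers c ≤ 3) {η θ T : ℕ} (hθ : 0 < θ)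
    (hgap : ∀ u v, c u u = c v v → (discrepancy γ c u v).card < θ →
      (discrepancy γ c u v).card ≤ η) (hT : Fintype.card V ^ 2 < 2 ^ T) :
    ∃ s ≤ T * (Fintype.card V / θ + 1), Identified (3 + (3 + 4 * s) * (η + 1) ^ 8 + s) c γ := by
  classical
  have : Std.Symm fun u v => γ (c u v) := ⟨hγ⟩
  obtain ⟨S, hScard, hS⟩ := exists_hitting_set (T := T) hθ
    (𝒟 := (Finset.univ.image fun p : V × V => discrepancy γ c p.1 p.2).filter (θ ≤ ·.card))
    (fun D hD => (Finset.mem_filter.1 hD).2)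
    ((Finset.card_filter_le _ _).trans_lt (Finset.card_image_le.trans_lt (by simpa [← sq])))
  have hhit : ∀ u v, θ ≤ (discrepancy γ c u v).card → ∃ s ∈ S, s ∈ discrepancy γ c u v :=
    fun u v h => hS _ (Finset.mem_filter.2 ⟨Finset.mem_image.2 ⟨(u, v), Finset.mem_univ _, rfl⟩, h⟩)
  refine ⟨S.card, hScard, ?_⟩
  obtain ⟨K', y, π, hI⟩ := exists_individualization hc.diag S
  let G := flippedGraph (fun u v => γ (c u v)) y
  have hG : ∀ u v u' v', y u v = y u' v' → G.Adj u v → G.Adj u' v' := fun u v u' v' =>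
    hI.coherent.flippedGraph_adj_congr fun u v u' v' h => by rw [hI.finer _ _ _ _ h]
  have hdeg := hI.finer.card_flippedGraph_adj_le hI.coherent hI.separates hhit hgap
  obtain ⟨N, hN, hcover⟩ := hs.exists_cover h3 hI hG
  have hcomp := card_reachable_le hdeg (by omega) hN hcover
  obtain ⟨E, hE⟩ : ∃ E : K' → Prop, ∀ u v, E (y u v) ↔ G.Reachable u v :=
    ⟨fun a => ∃ u v, y u v = a ∧ G.Reachable u v, fun u v => ⟨by
      rintro ⟨u', v', h, ⟨p⟩⟩
      obtain ⟨q, -⟩ := hI.coherent.exists_walk_length_eq hG p h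
      exact ⟨q⟩, fun h => ⟨u, v, rfl, h⟩⟩⟩
  refine hI.identified _ γ (by omega) (Identified.of_components (by omega) E ?_ ?_ fun p => ?_)
  · simpa only [hE] using G.reachable_is_equivalence
  · intro u v u' v' huv huv' hu hv
    rw [hI.proj, hI.proj]
    exact adj_iff_of_not_reachable hu hv (mt (hE _ _).2 huv) (mt (hE _ _).2 huv')
  · have : Nonempty {v // E (y p v)} := ⟨p, (hE p p).2 .rfl⟩
    refine Identified.of_card_le ((Eq.trans_le ?_ (hcomp p)).trans (Nat.le_add_left _ _))
    simp only [hE, Nat.card_eq_fintype_card, Fintype.card_subtype]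
    rfl

theorem mul_scale_le {n T e s : ℕ} (hT : 2 ≤ T) (he : 10 ≤ e)
    (hs : s ≤ T * (n / T ^ (10 * e) + 1)) :
    T * (3 + (3 + 4 * s) * (T ^ e + 1) ^ 8 + s) ≤ 5 * n + 11 * T ^ (10 * e) := by
  have hη : T ^ e + 1 ≤ T ^ (e + 1) :=
    Nat.pow_lt_pow_right (by omega) (Nat.lt_succ_self e)
  set H := (T ^ e + 1) ^ 8
  have hTTH : T * T * H ≤ T ^ (10 * e) := by
    calc T * T * H ≤ T * T * (T ^ (e + 1)) ^ 8 :=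
        Nat.mul_le_mul_left _ (Nat.pow_le_pow_left hη 8)
      _ = T ^ (8 * e + 10) := by ring
      _ ≤ T ^ (10 * e) := Nat.pow_le_pow_right (by omega) (by omega)
  have hH1 : 1 ≤ H := Nat.one_le_pow _ _ (Nat.succ_pos _)
  set θ := T ^ (10 * e)
  have hTsH : T * (s * H) ≤ n + θ := by
    calc T * (s * H) ≤ T * (T * (n / θ + 1) * H) := by gcongr
      _ = (T * T * H) * (n / θ) + T * T * H := by ring
      _ ≤ θ * (n / θ) + θ := by gcongr
      _ ≤ n + θ := Nat.add_le_add_right (Nat.mul_div_le n θ) _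
  have hTH : T * H ≤ θ :=
    (Nat.mul_le_mul_right H (Nat.le_mul_of_pos_right T (by omega))).trans hTTH
  have hTs : T * s ≤ T * (s * H) := Nat.mul_le_mul_left _ (Nat.le_mul_of_pos_right _ hH1)
  have hT' : T ≤ T * H := Nat.le_mul_of_pos_right _ hH1
  calc T * (3 + (3 + 4 * s) * H + s) = 3 * T + 3 * (T * H) + 4 * (T * (s * H)) + T * s := by ring
    _ ≤ 5 * n + 11 * θ := by omega

/-- The number of pebbles with which stuck configurations on at most `n` vertices are identified.
The scale `T` is about `2 * log n`, and `E` is a large constant. -/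
def numPebbles (E T n : ℕ) : ℕ :=
  (5 * n + 11 * T ^ E) / T

theorem three_le_numPebbles {E T : ℕ} (hE : E ≠ 0) (hT : 0 < T) (n : ℕ) :
    3 ≤ numPebbles E T n := by
  rw [numPebbles, Nat.le_div_iff_mul_le hT]
  have := Nat.le_self_pow hE T
  omega

theorem Stuck.identified_of_numFibers_le [Nonempty V] (hs : Stuck c) (hc : Coherent c)
    (hγ : ∀ u v, γ (c u v) → γ (c v u)) (h3 : numFibers c ≤ 3) {T n E : ℕ} (hE : 10 ^ 14 ≤ E)
    (hT2 : 2 ≤ T) (hn : Fintype.card V ≤ n) (hT : n ^ 2 < 2 ^ T) :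
    Identified (numPebbles E T n) c γ := by
  obtain ⟨D, hD, hmem⟩ := hs.exists_discrepancies hc γ
  have hmono : Monotone fun i : ℕ => T ^ 10 ^ (i + 1) := fun i j hij =>
    Nat.pow_le_pow_right (by omega) (Nat.pow_le_pow_right (by norm_num) (by omega))
  -- There are at most 12 discrepancies, so `i ≤ 12` and `10 ^ (i + 2) ≤ 10 ^ 14`.
  obtain ⟨i, hi, hgap⟩ := exists_gap hmono D
  obtain ⟨s, hsle, hI⟩ := hs.identified_of_gap hc hγ h3 (η := T ^ 10 ^ (i + 1))
    (θ := T ^ 10 ^ (i + 1 + 1)) (pow_pos (by omega) _)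
    (fun u v huv h => (hgap _ (hmem u v huv) h).le) ((Nat.pow_le_pow_left hn 2).trans_lt hT)
  have hexp : 10 ^ (i + 1 + 1) = 10 * 10 ^ (i + 1) := pow_succ' _ _
  refine hI.mono ((Nat.le_div_iff_mul_le (by omega)).2 ?_)
  rw [mul_comm]
  calc T * (3 + (3 + 4 * s) * (T ^ 10 ^ (i + 1) + 1) ^ 8 + s)
      ≤ 5 * Fintype.card V + 11 * T ^ (10 * 10 ^ (i + 1)) :=
        mul_scale_le hT2 (Nat.le_self_pow (Nat.succ_ne_zero i) 10) (hexp ▸ hsle)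
    _ ≤ 5 * n + 11 * T ^ E := by
        rw [← hexp]
        gcongr
        · omega
        · exact (Nat.pow_le_pow_right (by norm_num) (by omega)).trans hE

end Gap

section Individualization

variable {V : Type u} [Fintype V] {K : Type v} {c : V → V → K} {γ : K → Prop}

theorem numFibers_le_card (c : V → V → K) : numFibers c ≤ Fintype.card V := by
  classical exact Finset.card_image_le

theorem Coherent.identified_of_stuck [Nonempty V] {b : ℕ} (hb : 3 ≤ b)
    (hstuck : ∀ (K : Type v) (c : V → V → K) (γ : K → Prop), Coherent c → Stuck c →
      (∀ u v, γ (c u v) → γ (c v u)) → Identified b c γ)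
    (hc : Coherent c) (hγ : ∀ u v, γ (c u v) → γ (c v u)) :
    Identified (b + (Fintype.card V - numFibers c) / 4) c γ := by
  induction hm : Fintype.card V - numFibers c using Nat.strong_induction_on generalizing K with
  | _ m ih =>
  by_cases hs : Stuck c
  · exact (hstuck K c γ hc hs hγ).mono (Nat.le_add_right _ _)
  rw [Stuck] at hs
  push Not at hs
  obtain ⟨S, hne, hS⟩ := hs
  obtain ⟨K', c', π, hI⟩ := exists_individualization hc.diag S
  have hgrow := hS K' c' hI.coherent hI.finer hI.separates
  have hpos := hne.card_pos
  have hle := numFibers_le_card c'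
  have hγ' : ∀ u v, γ (π (c' u v)) → γ (π (c' v u)) := fun u v => by
    rw [hI.proj, hI.proj]
    exact hγ u v
  exact (hI.identified _ γ (by omega) (ih _ (by omega) hI.coherent hγ' rfl)).mono (by omega)

theorem Coherent.identified [Nonempty V] (hc : Coherent c)
    (hγ : ∀ u v, γ (c u v) → γ (c v u)) {T E : ℕ} (hE : 10 ^ 14 ≤ E) (hT2 : 2 ≤ T)
    (hT : Fintype.card V ^ 2 < 2 ^ T) :
    Identified (numPebbles E T (Fintype.card V) + Fintype.card V / 4) c γ := by
  have hb := three_le_numPebbles (by omega : E ≠ 0) (by omega : 0 < T) (Fintype.card V)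
  refine (hc.identified_of_stuck hb (fun K c γ hc hs hγ => ?_) hγ).mono (by omega)
  exact hs.identified_of_few_fibers hb hc hγ fun U _ _ e hU hse hce hγe h3 =>
    hse.identified_of_numFibers_le hce hγe h3 hE hT2 hU hT

end Individualization

end Rainbow

namespace WL

section Bridge

variable {V W : Type u} {C : Type v} [Fintype V] [Fintype W] {k : ℕ}
variable {G : SimpleGraph V} {χ : V → C} {H : SimpleGraph W} {ψ : W → C}

theorem exists_equiv_of_map_univ_eq {A : Type*} {f : V → A} {g : W → A}
    (h : (Finset.univ : Finset V).val.map f = (Finset.univ : Finset W).val.map g) :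
    ∃ σ : V ≃ W, ∀ v, g (σ v) = f v := by
  classical
  have hcard : ∀ a, Nonempty ({v // f v = a} ≃ {w // g w = a}) := fun a => by
    have hcount := congrArg (Multiset.count a) h
    rw [Multiset.count_map, Multiset.count_map] at hcount
    rw [← Fintype.card_eq, Fintype.card_subtype, Fintype.card_subtype]
    simpa only [Finset.card_def, Finset.filter_val, eq_comm] using hcount
  let e := fun a => (hcard a).some
  exact ⟨Equiv.ofFiberEquiv e, fun v => Equiv.ofFiberEquiv_map e v⟩

theorem atomicType_eq_of_roundColoring_eq {x : Fin k → V} {y : Fin k → W} (i : ℕ)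
    (h : roundColoring k G χ i x = roundColoring k H ψ i y) :
    atomicType G χ x = atomicType H ψ y := by
  induction i with
  | zero => exact h
  | succ i ih => exact ih (congrArg Prod.fst h)

theorem equivalent_stableRound (k : ℕ) (G : SimpleGraph V) (χ : V → C) :
    Equivalent (roundColoring k G χ (stableRound k G χ))
      (roundColoring k G χ (stableRound k G χ + 1)) :=
  Nat.sInf_mem (exists_stableRound k G χ)

theorem exists_coloring_eq_of_not_distinguishes (h : ¬ Distinguishes k G χ H ψ)
    (x : Fin k → V) : ∃ y, coloring k H ψ y = coloring k G χ x := by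
  rw [Distinguishes, not_not] at h
  have hx := Multiset.mem_map_of_mem (coloring k G χ) (Finset.mem_univ x)
  rw [h, Multiset.mem_map] at hx
  obtain ⟨y, -, hy⟩ := hx
  exact ⟨y, hy⟩

theorem stableRound_eq_of_not_distinguishes [Nonempty V] (h : ¬ Distinguishes k G χ H ψ) :
    stableRound k H ψ = stableRound k G χ := by
  obtain ⟨y, hy⟩ := exists_coloring_eq_of_not_distinguishes h fun _ => Classical.arbitrary V
  exact Nat.succ_injective (congrArg Sigma.fst hy)

theorem exists_roundColoring_eq_of_not_distinguishes [Nonempty V]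
    (h : ¬ Distinguishes k G χ H ψ) (x : Fin k → V) :
    ∃ y, roundColoring k G χ (stableRound k G χ + 1) x =
      roundColoring k H ψ (stableRound k G χ + 1) y := by
  obtain ⟨y, hy⟩ := exists_coloring_eq_of_not_distinguishes h x
  rw [coloring, coloring, stableRound_eq_of_not_distinguishes h, Sigma.mk.injEq] at hy
  exact ⟨y, (eq_of_heq hy.2).symm⟩

theorem roundColoring_succ_eq_of_not_distinguishes [Nonempty V]
    (h : ¬ Distinguishes k G χ H ψ) {x : Fin k → V} {y : Fin k → W}
    (hxy : roundColoring k G χ (stableRound k G χ) x =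
      roundColoring k H ψ (stableRound k G χ) y) :
    roundColoring k G χ (stableRound k G χ + 1) x =
      roundColoring k H ψ (stableRound k G χ + 1) y := by
  have hstable := equivalent_stableRound k H ψ
  rw [stableRound_eq_of_not_distinguishes h] at hstable
  obtain ⟨z, hz⟩ := exists_roundColoring_eq_of_not_distinguishes h x
  rw [hz]
  exact hstable.1 z y ((congrArg Prod.fst hz).symm.trans hxy)

/-- The colored graph `(G, χ)` as an edge-colored complete digraph. -/
def pairColor (G : SimpleGraph V) (χ : V → C) (u v : V) : Prop × Prop × C × C :=
  (u = v, G.Adj u v, χ u, χ v)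

theorem isBisim_of_not_distinguishes [Nonempty V] (hk : k ≠ 1) (h : ¬ Distinguishes k G χ H ψ) :
    Rainbow.IsBisim k (pairColor G χ) (pairColor H ψ) fun x y =>
      roundColoring k G χ (stableRound k G χ) x = roundColoring k H ψ (stableRound k G χ) y := by
  have hatomic : ∀ x y, roundColoring k G χ (stableRound k G χ) x =
      roundColoring k H ψ (stableRound k G χ) y → ∀ i j,
        pairColor G χ (x i) (x j) = pairColor H ψ (y i) (y j) := fun x y hxy i j => by
    have htype := atomicType_eq_of_roundColoring_eq _ hxy
    simp only [atomicType, Prod.mk.injEq, funext_iff] at htype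
    simp only [pairColor, Prod.mk.injEq]
    exact ⟨htype.2.1 i j, htype.2.2 i j, htype.1 i, htype.1 j⟩
  refine ⟨hatomic, fun x y hxy i j => iff_of_eq (congrArg Prod.fst (hatomic x y hxy i j)),
    fun x y hxy => ?_⟩
  have hmultiset := congrArg Prod.snd (roundColoring_succ_eq_of_not_distinguishes h hxy)
  simp only [roundColoring, substitutes, if_neg hk] at hmultiset
  obtain ⟨σ, hσ⟩ := exists_equiv_of_map_univ_eq hmultiset
  exact ⟨σ, fun w j => (congrFun (hσ w) j).symm⟩

theorem pebbleEquiv_of_not_distinguishes [Nonempty V] (hk : k ≠ 1)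
    (h : ¬ Distinguishes k G χ H ψ) :
    Rainbow.PebbleEquiv k (pairColor G χ) (pairColor H ψ) := by
  obtain ⟨y, hy⟩ := exists_roundColoring_eq_of_not_distinguishes h fun _ => Classical.arbitrary V
  exact ⟨_, isBisim_of_not_distinguishes hk h, _, y, congrArg Prod.fst hy⟩

theorem identifies_of_identified [Nonempty V] (hk : k ≠ 1)
    (h : Rainbow.Identified k (pairColor G χ) fun a => a.2.1) : Identifies k G χ := by
  intro W _ _ H ψ hiso
  by_contra hdist
  obtain ⟨φ, hdiag, hadj⟩ := h W _ (pebbleEquiv_of_not_distinguishes hk hdist)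
  exact hiso ⟨⟨φ, fun {a b} => hadj a b⟩, fun x => congrArg (fun p => p.2.2.1) (hdiag x)⟩

theorem identifies_of_sq_lt_two_pow [Nonempty V] (G : SimpleGraph V) (χ : V → C) {T E : ℕ}
    (hE : 10 ^ 14 ≤ E) (hT2 : 2 ≤ T) (hT : Fintype.card V ^ 2 < 2 ^ T) :
    Identifies (Rainbow.numPebbles E T (Fintype.card V) + Fintype.card V / 4) G χ := by
  have hb := Rainbow.three_le_numPebbles (by omega : E ≠ 0) (by omega : 0 < T) (Fintype.card V)
  obtain ⟨K, c, π, hI⟩ := Rainbow.exists_individualization (c := pairColor G χ)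
    (fun u v w h => by simpa [pairColor] using congrArg Prod.fst h) ∅
  have hk := hb.trans (Nat.le_add_right _ (Fintype.card V / 4))
  refine identifies_of_identified (by omega) (hI.identified _ _ hk
    (hI.coherent.identified (fun u v => ?_) hE hT2 hT))
  simp only [hI.proj]
  exact SimpleGraph.Adj.symm

theorem exists_dimension_eq {G : SimpleGraph V} {χ : V → C} (hk : 1 ≤ k)
    (h : Identifies k G χ) : ∃ d : ℕ, dimension G χ = d ∧ d ≤ k := by
  have hle : dimension G χ ≤ k := sInf_le ⟨k, rfl, hk, h⟩
  obtain ⟨d, hd⟩ := ENat.ne_top_iff_exists.1 (ne_top_of_le_ne_top (ENat.natCast_ne_top k) hle)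
  exact ⟨d, hd.symm, by rwa [← hd, Nat.cast_le] at hle⟩

end Bridge

section ErrorTerm

/-- A number `T = O(log n)` with `n ^ 2 < 2 ^ T`. -/
def logScale (n : ℕ) : ℕ :=
  2 * Nat.log 2 n + 2

theorem sq_lt_two_pow_logScale (n : ℕ) : n ^ 2 < 2 ^ logScale n := by
  calc n ^ 2 < (2 ^ (Nat.log 2 n + 1)) ^ 2 :=
        Nat.pow_lt_pow_left (Nat.lt_pow_succ_log_self (by norm_num) n) (by norm_num)
    _ = 2 ^ logScale n := by rw [← pow_mul, logScale]; ring_nf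

theorem tendsto_logScale : Tendsto logScale atTop atTop := by
  refine tendsto_atTop.2 fun b => ?_
  filter_upwards [eventually_ge_atTop (2 ^ b)] with n hn
  have := Nat.le_log_of_pow_le (b := 2) (by norm_num) hn
  rw [logScale]
  omega

theorem logScale_isBigO_log :
    (fun n => (logScale n : ℝ)) =O[atTop] fun n : ℕ => Real.log n := by
  refine IsBigO.of_bound 6 ?_
  filter_upwards [eventually_ge_atTop 3] with n hn
  have hlog : (1 : ℝ) ≤ Real.log n := by
    rw [Real.le_log_iff_exp_le (by positivity)]
    have : (3 : ℝ) ≤ n := by exact_mod_cast hn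
    linarith [Real.exp_one_lt_d9]
  have hlog2 : (Nat.log 2 n : ℝ) * Real.log 2 ≤ Real.log n := by
    rw [← Real.log_pow]
    exact Real.log_le_log (by positivity) (mod_cast Nat.pow_log_le_self 2 (by omega))
  have := Real.log_two_gt_d9
  have : (0 : ℝ) ≤ Nat.log 2 n := Nat.cast_nonneg _
  rw [Real.norm_of_nonneg (by positivity), Real.norm_of_nonneg (by linarith), logScale]
  push_cast
  nlinarith

/-- The excess of the bound on the dimension over `n / 4`. -/
noncomputable def errorTerm (E n : ℕ) : ℝ :=
  n * (5 / logScale n) + 11 * (logScale n : ℝ) ^ E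

theorem errorTerm_isLittleO (E : ℕ) : errorTerm E =o[atTop] fun n : ℕ => (n : ℝ) := by
  have hlinear : (fun n : ℕ => (n : ℝ) * (5 / logScale n)) =o[atTop] fun n : ℕ => (n : ℝ) := by
    simpa only [mul_one, Function.comp_def] using
      (isBigO_refl (fun n : ℕ => (n : ℝ)) atTop).mul_isLittleO ((isLittleO_one_iff ℝ).2
        ((tendsto_natCast_atTop_atTop.comp tendsto_logScale).const_div_atTop 5))
  have hpow := (logScale_isBigO_log.pow E).trans_isLittleO
    ((Real.isLittleO_pow_log_id_atTop (n := E)).comp_tendsto tendsto_natCast_atTop_atTop)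
  exact hlinear.add (hpow.const_mul_left 11)

theorem numPebbles_le_errorTerm (E n : ℕ) :
    (Rainbow.numPebbles E (logScale n) n : ℝ) ≤ errorTerm E n := by
  have hT : (1 : ℝ) ≤ logScale n := by
    rw [logScale]
    exact_mod_cast Nat.le_add_left 1 _
  calc (Rainbow.numPebbles E (logScale n) n : ℝ)
      ≤ ((5 * n + 11 * logScale n ^ E : ℕ) : ℝ) / logScale n := Nat.cast_div_le
    _ = n * (5 / logScale n) + 11 * (logScale n : ℝ) ^ E / logScale n := by
        push_cast
        ring
    _ ≤ errorTerm E n := by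
        rw [errorTerm]
        gcongr
        exact div_le_self (by positivity) hT

end ErrorTerm

end WL

theorem theorem1 :
    ∃ f : ℕ → ℝ, f =o[atTop] (fun n : ℕ => (n : ℝ)) ∧
      ∀ (V : Type u) [Fintype V] [Nonempty V] (C : Type v) (G : SimpleGraph V) (χ : V → C),
        ∃ d : ℕ, WL.dimension G χ = (d : ℕ∞) ∧
          (d : ℝ) ≤ (Fintype.card V : ℝ) / 4 + f (Fintype.card V) := by
  obtain ⟨E, hE⟩ : ∃ E : ℕ, 10 ^ 14 ≤ E := ⟨_, le_rfl⟩
  refine ⟨WL.errorTerm E, WL.errorTerm_isLittleO E, fun V _ _ C G χ => ?_⟩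
  have hT2 : 2 ≤ WL.logScale (Fintype.card V) := Nat.le_add_left _ _
  have hpebbles := Rainbow.three_le_numPebbles (by omega : E ≠ 0) (pos_of_gt hT2)
    (Fintype.card V)
  have hI := WL.identifies_of_sq_lt_two_pow G χ hE hT2 (WL.sq_lt_two_pow_logScale _)
  obtain ⟨d, hdim, hd⟩ := WL.exists_dimension_eq (by omega) hI
  refine ⟨d, hdim, ?_⟩
  calc (d : ℝ)
      ≤ Rainbow.numPebbles E (WL.logScale (Fintype.card V)) (Fintype.card V) +
          (Fintype.card V / 4 : ℕ) := mod_cast hd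
    _ ≤ WL.errorTerm E (Fintype.card V) + Fintype.card V / 4 :=
        add_le_add (WL.numPebbles_le_errorTerm E _) (mod_cast Nat.cast_div_le)
    _ = Fintype.card V / 4 + WL.errorTerm E (Fintype.card V) := add_comm _ _
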